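/- **Definitions.** A probability measure $\mu$ with finite moments of all orders on $\mathbb{R}$ has monic orthogonal polynomials $f_n$ (vanishing $\mu$-a.e. for $n\ge k$ if $\mu$ is carried by exactly $k$ points), with Szegő–Jacobi parameters $\alpha_n=\int x f_n^2\,d\mu\big/\int f_n^2\,d\mu$ $(n\ge 0)$ and $\omega_n=\int f_n^2\,d\mu\big/\int f_{n-1}^2\,d\mu$ $(n\ge1)$, with $0/0:=0$, so that $x f_n=f_{n+1}+\alpha_n f_n+\omega_n f_{n-1}$ $\mu$-a.e. Such a $\mu$ is a *Meixner probability measure of class $\mathcal{M}_L$ on $\mathbb{R}$* if one of the following holds: * its support is infinite, and there are reals $\alpha$, $\beta\ge 0$, $t>0$ with $\alpha\neq 0$ or $\alpha=\beta=0$, such that $\alpha_n=\alpha n+\alpha_0$ for all $n\ge 0$ and $\omega_n=\beta n^2+(t-\beta)n$ for all $n\ge1$; * its support has exactly $k$ points for some integer $k\ge1$, and there are reals $\alpha\ne 0$, $\beta$, $t$ with $t=-\beta(k-1)$, and $t>0$ if $k\ge2$, such that $\alpha_n=\alpha n+\alpha_0$ for $0\le n\le k-1$ and $\omega_n=\beta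 n^2+(t-\beta)n$ for $1\le n\le k-1$. Let $\mu$ be a probability measure on $\mathbb{R}^2$ with finite moments of all orders. Let $F_n\subset L^2(\mu)$ be the space of classes of polynomial functions of total degree at most $n$ ($F_n=\{0\}$ for $n<0$), $G_n:=F_n\ominus F_{n-1}$, $P_n$ the orthogonal projection onto $G_n$, and $V=\bigcup_n F_n$. Let $X$ and $Y$ be the operators on $V$ of multiplication by the coordinates $x$ and $y$. The annihilation, preservation and creation operators of $X$ are the operators $a_x^{\varepsilon}=\sum_n P_{n+\varepsilon}XP_n$ on $V$ for $\varepsilon=-1,0,1$, denoted $a_x^-,a_x^0,a_x^+$; likewise $a_y^-,a_y^0,a_y^+$ for $Y$. The measure $\mu$ is a *Meixner probability measure of class $\mathcal{M}_L$ on $\mathbb{R}^2$* if the real vector space spanned by $I,a_x^-,a_x^0,a_x^+,a_y^-,a_y^0,a_y^+$ is closed under the commutator $[A,B]=AB-BA$, i.e. forms a Lie algebra. **Statement.** Let $\mu$ be a Meixner probability measure of class $\mathcal{M}_L$ on $\mathbb{R}^2$ that is not supported by any line $ax+by=c$ with $a^2+b^2>0$. Then: 1. There exist an invertible linear transformation $S:\mathbb{R}^2\to\mathbb{R}^2$,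 a vector $c\in\mathbb{R}^2$ and two Meixner probability measures $\mu_1,\mu_2$ of class $\mathcal{M}_L$ on $\mathbb{R}$ such that $\mu(SB+c)=(\mu_1\otimes\mu_2)(B)$ for every Borel set $B\subset\mathbb{R}^2$, where $SB+c=\{S(x,y)+c : (x,y)\in B\}$. 2. If moreover $\mu$ is not supported by any finite union of such lines, then there exist $S$, $c$, $\mu_1$, $\mu_2$ as in 1 for which both $\mu_1$ and $\mu_2$ have infinite support. -/

import Mathlib

open MeasureTheory

/-- All moments of `μ` are finite. -/
def HasFiniteMoments {E : Type*} [NormedAddCommGroup E] [MeasurableSpace E]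
    (μ : Measure E) : Prop :=
  ∀ n : ℕ, Integrable (fun z => ‖z‖ ^ n) μ

/-! ### The class `M_L` on the line, through Szegő–Jacobi parameters -/

section Line

open Polynomial

/-- The squared norm of a polynomial in `L²(μ)`. -/
noncomputable def polyNormSq (μ : Measure ℝ) (p : ℝ[X]) : ℝ :=
  ∫ x, p.eval x ^ 2 ∂μ

/-- The coefficient `⟨x p, p⟩ / ⟨p, p⟩`; it is `0` if `p = 0` almost everywhere. -/
noncomputable def polyMean (μ : Measure ℝ) (p : ℝ[X]) : ℝ :=
  (∫ x, x * p.eval x ^ 2 ∂μ) / polyNormSq μ p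

/-- The monic orthogonal polynomials of `μ`, given by the three-term recurrence
`f (n+1) = (x - α_n) f n - ω_n f (n-1)`, where
`α_n = ⟨x f n, f n⟩ / ⟨f n, f n⟩` and `ω_n = ⟨f n, f n⟩ / ⟨f (n-1), f (n-1)⟩`. If `μ` has exactly `k` atoms and no other mass, then
`f n = 0` almost everywhere for all `n ≥ k`. -/
noncomputable def orthoPoly (μ : Measure ℝ) : ℕ → ℝ[X]
  | 0 => 1
  | 1 => X - C (polyMean μ 1)
  | n + 2 =>
      (X - C (polyMean μ (orthoPoly μ (n + 1)))) * orthoPoly μ (n + 1)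
        - C (polyNormSq μ (orthoPoly μ (n + 1)) / polyNormSq μ (orthoPoly μ n)) * orthoPoly μ n

/-- The Szegő–Jacobi parameter `α_n`. It is `0` for `n ≥ k` if `μ` lives on exactly `k` points. -/
noncomputable def jacobiAlpha (μ : Measure ℝ) (n : ℕ) : ℝ :=
  polyMean μ (orthoPoly μ n)

/-- The Szegő–Jacobi parameter `ω_n`, `n ≥ 1` (the value at `n = 0` is immaterial).
It is `0` for `n ≥ k` if `μ` lives on exactly `k` points. -/
noncomputable def jacobiOmega (μ : Measure ℝ) (n : ℕ) : ℝ :=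
  polyNormSq μ (orthoPoly μ n) / polyNormSq μ (orthoPoly μ (n - 1))

/-- The class `M_{u,f}`: infinite support, `α_n = α n + α_0`, `ω_n = β n² + (t - β) n`,
with `α ≠ 0` or `α = β = 0`. -/
def IsMeixnerInfinite (μ : Measure ℝ) : Prop :=
  μ.support.Infinite ∧
    ∃ α β t : ℝ, 0 ≤ β ∧ 0 < t ∧ (α ≠ 0 ∨ (α = 0 ∧ β = 0)) ∧
      (∀ n : ℕ, jacobiAlpha μ n = α * n + jacobiAlpha μ 0) ∧
      (∀ n : ℕ, 1 ≤ n → jacobiOmega μ n = β * n ^ 2 + (t - β) * n)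

/-- The class `M_{b,f}` of non-symmetric binomial distributions: support of exactly `k` points,
`α_n = α n + α_0` and `ω_n = β n² + (t - β) n` for `n ≤ k - 1`,
with `t = - β (k - 1)` and `α ≠ 0`. -/
def IsMeixnerFinite (μ : Measure ℝ) : Prop :=
  ∃ k : ℕ, 1 ≤ k ∧ μ.support.encard = k ∧
    ∃ α β t : ℝ, α ≠ 0 ∧ (2 ≤ k → 0 < t) ∧ t = -β * ((k : ℝ) - 1) ∧
      (∀ n : ℕ, n < k → jacobiAlpha μ n = α * n + jacobiAlpha μ 0) ∧
      (∀ n : ℕ, 1 ≤ n → n < k → jacobiOmega μ n = β * n ^ 2 + (t - β) * n)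

/-- `μ` is a Meixner probability measure of class `M_L = M_{u,f} ∪ M_{b,f}` on the line. -/
def IsMeixnerLie (μ : Measure ℝ) : Prop :=
  IsProbabilityMeasure μ ∧ HasFiniteMoments μ ∧ (IsMeixnerInfinite μ ∨ IsMeixnerFinite μ)

end Line

/-! ### The class `M_L` on the plane, through annihilation, preservation, creation operators -/

section Plane

variable {μ : Measure (ℝ × ℝ)}

theorem HasFiniteMoments.memLp (h : HasFiniteMoments μ) (a b : ℕ) :
    MemLp (fun z : ℝ × ℝ => z.1 ^ a * z.2 ^ b) 2 μ := by
  have hm : AEStronglyMeasurable (fun z : ℝ × ℝ => z.1 ^ a * z.2 ^ b) μ :=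
    (by fun_prop : Continuous fun z : ℝ × ℝ => z.1 ^ a * z.2 ^ b).aestronglyMeasurable
  rw [memLp_two_iff_integrable_sq hm]
  refine (h (2 * (a + b))).mono' (by fun_prop) (Filter.Eventually.of_forall fun z => ?_)
  have h1 : ‖z.1‖ ≤ ‖z‖ := norm_fst_le z
  have h2 : ‖z.2‖ ≤ ‖z‖ := norm_snd_le z
  rw [norm_pow, norm_mul, norm_pow, norm_pow, mul_comm 2, pow_mul, pow_add]
  gcongr

/-- The class of `x ^ a * y ^ b` in `L²(μ)`. -/
noncomputable def monomialL2 (h : HasFiniteMoments μ) (a b : ℕ) : Lp ℝ 2 μ :=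
  (h.memLp a b).toLp _

/-- The space of (classes of) polynomial functions in `L²(μ)`: the common domain of all
operators below, `𝒜 φ` with `φ = 1`. -/
noncomputable def polySpace (h : HasFiniteMoments μ) : Submodule ℝ (Lp ℝ 2 μ) :=
  Submodule.span ℝ {g | ∃ a b : ℕ, g = monomialL2 h a b}

/-- `F n`, the classes of polynomials of total degree at most `n` (null for `n < 0`). -/
noncomputable def degLE (h : HasFiniteMoments μ) (n : ℤ) : Submodule ℝ (polySpace h) :=
  Submodule.span ℝ {g | ∃ a b : ℕ, (a : ℤ) + b ≤ n ∧ (g : Lp ℝ 2 μ) = monomialL2 h a b}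

/-- The homogeneous chaos space `G n = F n ⊖ F (n - 1)` (null for `n < 0`). -/
noncomputable def chaos (h : HasFiniteMoments μ) (n : ℤ) : Submodule ℝ (polySpace h) :=
  degLE h n ⊓ (degLE h (n - 1))ᗮ

theorem degLE_mono (h : HasFiniteMoments μ) {m n : ℤ} (hmn : m ≤ n) :
    degLE h m ≤ degLE h n :=
  Submodule.span_mono fun _ ⟨a, b, hab, hg⟩ => ⟨a, b, hab.trans hmn, hg⟩

instance degLE_finite (h : HasFiniteMoments μ) (n : ℤ) :
    FiniteDimensional ℝ (degLE h n) := by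
  refine FiniteDimensional.span_of_finite ℝ (Set.Finite.subset
    (Set.Finite.image (fun ab : ℕ × ℕ =>
      (⟨monomialL2 h ab.1 ab.2, Submodule.subset_span ⟨_, _, rfl⟩⟩ : polySpace h))
      ((Set.finite_Iic n.toNat).prod (Set.finite_Iic n.toNat))) ?_)
  rintro g ⟨a, b, hab, hg⟩
  exact ⟨(a, b), ⟨by simp only [Set.mem_Iic]; omega, by simp only [Set.mem_Iic]; omega⟩,
    Subtype.ext hg.symm⟩

instance chaos_finite (h : HasFiniteMoments μ) (n : ℤ) : FiniteDimensional ℝ (chaos h n) :=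
  Submodule.finiteDimensional_of_le inf_le_left

theorem exists_mem_degLE (h : HasFiniteMoments μ) (u : polySpace h) :
    ∃ N : ℤ, 0 ≤ N ∧ u ∈ degLE h N := by
  obtain ⟨u, hu⟩ := u
  induction hu using Submodule.span_induction with
  | mem x hx =>
    obtain ⟨a, b, rfl⟩ := hx
    exact ⟨a + b, by positivity, Submodule.subset_span ⟨a, b, le_rfl, rfl⟩⟩
  | zero => exact ⟨0, le_rfl, Submodule.zero_mem _⟩
  | add x y hx hy ihx ihy =>
    obtain ⟨N, hN, h1⟩ := ihx
    obtain ⟨M, hM, h2⟩ := ihy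
    exact ⟨max N M, le_max_of_le_left hN, Submodule.add_mem _
      (degLE_mono h (le_max_left N M) h1) (degLE_mono h (le_max_right N M) h2)⟩
  | smul c x hx ihx =>
    obtain ⟨N, hN, h1⟩ := ihx
    exact ⟨N, hN, Submodule.smul_mem _ c h1⟩

theorem chaos_proj_finite (h : HasFiniteMoments μ) (u : polySpace h) :
    {n : ℤ | (chaos h n).starProjection u ≠ 0}.Finite := by
  obtain ⟨N, hN, hu⟩ := exists_mem_degLE h u
  refine (Set.finite_Icc 0 N).subset fun n hn => ?_
  by_contra hc
  apply hn
  rw [Submodule.starProjection_apply_eq_zero_iff]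
  rw [Set.mem_Icc, not_and_or, not_le, not_le] at hc
  rcases hc with hc | hc
  · have h0 : degLE h n = ⊥ := by
      rw [degLE, Submodule.span_eq_bot]
      rintro g ⟨a, b, hab, -⟩
      omega
    have h1 : chaos h n = ⊥ := by rw [chaos, h0, bot_inf_eq]
    simp [h1]
  · rw [Submodule.mem_orthogonal']
    intro v hv
    exact Submodule.inner_right_of_mem_orthogonal
      (degLE_mono h (by omega : N ≤ n - 1) hu) hv.2

/-- The coordinate functions `x` (index `0`) and `y` (index `1`) of the plane. -/
def coordFun : Fin 2 → ℝ × ℝ → ℝ := ![Prod.fst, Prod.snd]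

theorem exists_coordMul (h : HasFiniteMoments μ) (i : Fin 2) (u : polySpace h) :
    ∃ v : polySpace h, (v : Lp ℝ 2 μ) =ᵐ[μ] fun z => coordFun i z * (u : Lp ℝ 2 μ) z := by
  obtain ⟨u, hu⟩ := u
  induction hu using Submodule.span_induction with
  | mem x hx =>
    obtain ⟨a, b, rfl⟩ := hx
    have hab := (h.memLp a b).coeFn_toLp
    fin_cases i
    · refine ⟨⟨monomialL2 h (a + 1) b, Submodule.subset_span ⟨_, _, rfl⟩⟩, ?_⟩
      filter_upwards [hab, (h.memLp (a + 1) b).coeFn_toLp] with z h1 h2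
      simp only [monomialL2, h1, h2, coordFun]
      simp
      ring
    · refine ⟨⟨monomialL2 h a (b + 1), Submodule.subset_span ⟨_, _, rfl⟩⟩, ?_⟩
      filter_upwards [hab, (h.memLp a (b + 1)).coeFn_toLp] with z h1 h2
      simp only [monomialL2, h1, h2, coordFun]
      simp
      ring
  | zero =>
    refine ⟨0, ?_⟩
    filter_upwards [Lp.coeFn_zero ℝ 2 μ] with z h1
    simp only [Submodule.coe_zero, h1, Pi.zero_apply, mul_zero]
  | add x y hx hy ihx ihy =>
    obtain ⟨v, hv⟩ := ihx
    obtain ⟨w, hw⟩ := ihy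
    refine ⟨v + w, ?_⟩
    filter_upwards [hv, hw, Lp.coeFn_add (v : Lp ℝ 2 μ) w, Lp.coeFn_add x y] with z h1 h2 h3 h4
    simp only [Submodule.coe_add, h3, h4, Pi.add_apply, h1, h2]
    ring
  | smul c x hx ihx =>
    obtain ⟨v, hv⟩ := ihx
    refine ⟨c • v, ?_⟩
    filter_upwards [hv, Lp.coeFn_smul c (v : Lp ℝ 2 μ), Lp.coeFn_smul c x] with z h1 h2 h3
    simp only [Submodule.coe_smul, h2, h3, Pi.smul_apply, h1, smul_eq_mul]
    ring

/-- The operator of multiplication by the coordinate `x` or `y` on polynomial functions: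
the image of `u` is the class that is almost everywhere equal to `coordFun i * u`. -/
noncomputable def coordMul (h : HasFiniteMoments μ) (i : Fin 2) :
    Module.End ℝ (polySpace h) where
  toFun u := (exists_coordMul h i u).choose
  map_add' u w := by
    apply Subtype.ext
    apply Lp.ext
    have hu := (exists_coordMul h i u).choose_spec
    have hw := (exists_coordMul h i w).choose_spec
    filter_upwards [hu, hw, (exists_coordMul h i (u + w)).choose_spec,
      Lp.coeFn_add (u : Lp ℝ 2 μ) w,
      Lp.coeFn_add ((exists_coordMul h i u).choose : Lp ℝ 2 μ)
        (exists_coordMul h i w).choose] with z h1 h2 h3 h4 h5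
    simp only [Submodule.coe_add] at h3 ⊢
    simp only [h3, h4, h5, Pi.add_apply, h1, h2]
    ring
  map_smul' c u := by
    apply Subtype.ext
    apply Lp.ext
    filter_upwards [(exists_coordMul h i u).choose_spec,
      (exists_coordMul h i (c • u)).choose_spec,
      Lp.coeFn_smul c (u : Lp ℝ 2 μ),
      Lp.coeFn_smul c ((exists_coordMul h i u).choose : Lp ℝ 2 μ)] with z h1 h2 h3 h4
    simp only [Submodule.coe_smul, RingHom.id_apply] at h2 ⊢
    simp only [h2, h3, h4, Pi.smul_apply, h1, smul_eq_mul]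
    ring

/-- The part of degree `k` of an operator `T` with respect to the chaos decomposition:
`∑ n, P (n + k) ∘ T ∘ P n`, where `P n` is the orthogonal projection onto `chaos h n`.
On each vector only finitely many terms are nonzero. -/
noncomputable def degPart (h : HasFiniteMoments μ) (k : ℤ) (T : Module.End ℝ (polySpace h)) :
    Module.End ℝ (polySpace h) where
  toFun u := ∑ᶠ n : ℤ, (chaos h (n + k)).starProjection (T ((chaos h n).starProjection u))
  map_add' u w := by
    rw [← finsum_add_distrib]
    · simp only [map_add]
    · refine (chaos_proj_finite h u).subset fun n hn h0 => hn ?_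
      simp [h0]
    · refine (chaos_proj_finite h w).subset fun n hn h0 => hn ?_
      simp [h0]
  map_smul' c u := by
    rw [RingHom.id_apply, smul_finsum]
    simp only [map_smul]

/-- The annihilation (`ε = -1`), preservation (`ε = 0`) and creation (`ε = 1`) operators
`a_x^ε` (`i = 0`) and `a_y^ε` (`i = 1`) generated by multiplication by the coordinates. -/
noncomputable def apc (h : HasFiniteMoments μ) (i : Fin 2) (ε : ℤ) :
    Module.End ℝ (polySpace h) :=
  degPart h ε (coordMul h i)

/-- The real vector space `W` spanned by `I` and the annihilation, preservation and creation
operators of both coordinates. -/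
noncomputable def apcSpan (h : HasFiniteMoments μ) :
    Submodule ℝ (Module.End ℝ (polySpace h)) :=
  Submodule.span ℝ {1, apc h 0 (-1), apc h 0 0, apc h 0 1, apc h 1 (-1), apc h 1 0, apc h 1 1}

end Plane

/-- `μ` is a Meixner probability measure of class `M_L` on the plane: it has finite moments of
all orders and `W` is closed under the commutator, hence a Lie algebra. -/
def IsMeixnerLiePlane (μ : Measure (ℝ × ℝ)) : Prop :=
  IsProbabilityMeasure μ ∧ ∃ h : HasFiniteMoments μ,
    ∀ A ∈ apcSpan h, ∀ B ∈ apcSpan h, A * B - B * A ∈ apcSpan h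

/-- A line `a x + b y = c` with `a² + b² > 0`. -/
def IsLine (l : Set (ℝ × ℝ)) : Prop :=
  ∃ a b c : ℝ, 0 < a ^ 2 + b ^ 2 ∧ l = {z | a * z.1 + b * z.2 = c}

/-- `μ` is supported by the set `s`. -/
def IsSupportedOn (μ : Measure (ℝ × ℝ)) (s : Set (ℝ × ℝ)) : Prop :=
  μ sᶜ = 0

/-!
The generators of the Lie algebra are homogeneous for the chaos degree, so closure under commutators
and the identity `[X, Y] = 0` can be compared degree by degree. Write `Am v`, `A0 v`, `Ap v` for
the annihilation, preservation and creation operators of the linear form `v` and `N v` for `A0 v`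
minus the mean of `v`. Then `[N v, Ap w] = Ap (v ∘ w)` for a product `∘` on the plane, and
`[Am v, Ap w]` is a constant plus some `N q` (`ladderSystem_of_lie`). As `μ` lives on no line, `v` is
determined by the vector `Ap v 1`, and the covariance of `μ` is an inner product on the plane. The
product `∘` is commutative, its multiplications are symmetric, and they commute with each other, so
they have a common orthonormal eigenbasis `e 0, e 1`, in which `e 0 ∘ e 1 = 0`
(`LadderSystem.exists_diagonal`). The Jacobi identity and adjointness then remove all mixed
commutators (`LadderSystem.exists_splitting`).

In the coordinates of this basis, the vectors `(Ap (e 0)) ^ m (Ap (e 1)) ^ n 1` are obtained by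
applying to `1` the products of two sequences of monic polynomials with Szegő–Jacobi parameters
`α_n = α n` and `ω_n = n (1 + β (n - 1))`. For `(m, n) ≠ (0, 0)` they are orthogonal to `1`, so the
mixed means of these polynomials vanish (`exists_affine_meixner`).

On the line, vanishing means and the recurrence already make the polynomials orthogonal, and the
sign of the numbers `ω_n` decides between infinite support and a binomial law
(`isMeixnerLie_of_integral_meixnerPoly`). In the plane, all mixed moments of the two coordinates
factor (`integral_pow_mul_pow`). The recurrence bounds the `n`-th moment by `D ^ n * n!`
(`exists_moment_bound`), so the coordinates are exponentially integrable, the moments determine the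
joint law, and it is a product (`map_prod_eq_of_moments`). If one factor has finite support, the
measure is carried by finitely many parallel lines, which gives the second claim.
-/

/-! ### The chaos decomposition -/

section Grading

variable {μ : Measure (ℝ × ℝ)} (h : HasFiniteMoments μ)

set_option synthInstance.maxHeartbeats 400000 in
/-- A shortcut instance: the general search exceeds the default limit. -/
instance chaos_hasOrthogonalProjection (n : ℤ) : (chaos h n).HasOrthogonalProjection :=
  inferInstance

set_option synthInstance.maxHeartbeats 400000 in
/-- A shortcut instance: the general search exceeds the default limit. -/
instance degLE_hasOrthogonalProjection (n : ℤ) : (degLE h n).HasOrthogonalProjection :=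
  inferInstance

theorem degLE_of_neg {n : ℤ} (hn : n < 0) : degLE h n = ⊥ := by
  rw [degLE, Submodule.span_eq_bot]
  rintro g ⟨a, b, hab, -⟩
  omega

theorem chaos_of_neg {n : ℤ} (hn : n < 0) : chaos h n = ⊥ := by
  rw [chaos, degLE_of_neg h hn, bot_inf_eq]

theorem inner_eq_zero_of_mem_chaos {m n : ℤ} (hmn : m ≠ n) {u w : polySpace h}
    (hu : u ∈ chaos h m) (hw : w ∈ chaos h n) : inner ℝ u w = 0 := by
  rcases lt_or_gt_of_ne hmn with hlt | hlt
  · exact Submodule.inner_right_of_mem_orthogonal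
      (degLE_mono h (by omega : m ≤ n - 1) hu.1) hw.2
  · exact Submodule.inner_left_of_mem_orthogonal
      (degLE_mono h (by omega : n ≤ m - 1) hw.1) hu.2

theorem chaos_proj_self {n : ℤ} {u : polySpace h} (hu : u ∈ chaos h n) :
    (chaos h n).starProjection u = u :=
  Submodule.starProjection_eq_self_iff.2 hu

theorem chaos_proj_eq_zero {m n : ℤ} (hmn : m ≠ n) {u : polySpace h} (hu : u ∈ chaos h m) :
    (chaos h n).starProjection u = 0 := by
  rw [Submodule.starProjection_apply_eq_zero_iff, Submodule.mem_orthogonal']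
  exact fun v hv => inner_eq_zero_of_mem_chaos h hmn hu hv

theorem chaos_proj_mem (n : ℤ) (u : polySpace h) : (chaos h n).starProjection u ∈ chaos h n :=
  Submodule.starProjection_apply_mem _ u

/-- The chaos spaces span: `F n` is the sum of `F (n - 1)` and its complement `G n`. -/
theorem iSup_chaos : ⨆ n, chaos h n = ⊤ := by
  have key : ∀ n : ℕ, degLE h ((n : ℤ) - 1) ≤ ⨆ n, chaos h n := by
    intro n
    induction n with
    | zero => rw [degLE_of_neg h (by simp)]; exact bot_le
    | succ n ih =>
      intro u hu
      have hQ : (degLE h ((n : ℤ) - 1)).starProjection u ∈ degLE h ((n : ℤ) - 1) :=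
        Submodule.starProjection_apply_mem _ u
      have hR : u - (degLE h ((n : ℤ) - 1)).starProjection u ∈ chaos h n := by
        refine ⟨Submodule.sub_mem _ (by simpa using hu)
          (degLE_mono h (by omega) hQ), ?_⟩
        exact Submodule.sub_starProjection_mem_orthogonal u
      have := Submodule.add_mem _ (ih hQ) (Submodule.mem_iSup_of_mem (n : ℤ) hR)
      simpa using this
  rw [eq_top_iff]
  intro u _
  obtain ⟨N, hN, hu⟩ := exists_mem_degLE h u
  lift N to ℕ using hN
  exact key (N + 1) (by simpa using hu)

/-- Operators on polynomial functions are determined by their values on the chaos spaces. -/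
theorem end_ext {A B : Module.End ℝ (polySpace h)}
    (hAB : ∀ (n : ℤ), ∀ u ∈ chaos h n, A u = B u) : A = B := by
  ext1 u
  have hu : u ∈ ⨆ n, chaos h n := by rw [iSup_chaos]; trivial
  induction hu using Submodule.iSup_induction' with
  | mem i x hx => exact hAB i x hx
  | zero => simp
  | add x y _ _ hx hy => rw [map_add, map_add, hx, hy]

theorem eq_zero_of_forall_inner_chaos {d : polySpace h}
    (hd : ∀ (n : ℤ), ∀ v ∈ chaos h n, inner ℝ d v = 0) : d = 0 := by
  have key : ∀ u ∈ ⨆ n, chaos h n, inner ℝ d u = 0 := by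
    intro u hu
    induction hu using Submodule.iSup_induction' with
    | mem i x hx => exact hd i x hx
    | zero => simp
    | add x y _ _ hx hy => rw [inner_add_right, hx, hy, add_zero]
  rw [iSup_chaos] at key
  exact inner_self_eq_zero.1 (key d trivial)

theorem inner_chaos_proj {j k : ℤ} (w : polySpace h) {v : polySpace h} (hv : v ∈ chaos h k) :
    inner ℝ ((chaos h j).starProjection w) v = if j = k then inner ℝ w v else 0 := by
  rw [Submodule.inner_starProjection_left_eq_right]
  split_ifs with hjk
  · subst hjk; rw [chaos_proj_self h hv]
  · rw [chaos_proj_eq_zero h (Ne.symm hjk) hv, inner_zero_right]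

/-! ### Multiplication by the coordinates -/

theorem coordMul_ae (i : Fin 2) (u : polySpace h) :
    (coordMul h i u : Lp ℝ 2 μ) =ᵐ[μ] fun z => coordFun i z * (u : Lp ℝ 2 μ) z :=
  (exists_coordMul h i u).choose_spec

theorem coordMul_mem_degLE (i : Fin 2) {n : ℤ} {u : polySpace h} (hu : u ∈ degLE h n) :
    coordMul h i u ∈ degLE h (n + 1) := by
  induction hu using Submodule.span_induction with
  | mem x hx =>
    obtain ⟨a, b, hab, hx⟩ := hx
    have hu := coordMul_ae h i x
    rw [hx] at hu
    have h1 := (h.memLp a b).coeFn_toLp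
    fin_cases i
    · refine Submodule.subset_span ⟨a + 1, b, by push_cast; omega, Lp.ext ?_⟩
      filter_upwards [hu, h1, (h.memLp (a + 1) b).coeFn_toLp] with z h2 h3 h4
      simp only [monomialL2] at h2 ⊢
      rw [h2, h3, h4]
      simp [coordFun]
      ring
    · refine Submodule.subset_span ⟨a, b + 1, by push_cast; omega, Lp.ext ?_⟩
      filter_upwards [hu, h1, (h.memLp a (b + 1)).coeFn_toLp] with z h2 h3 h4
      simp only [monomialL2] at h2 ⊢
      rw [h2, h3, h4]
      simp [coordFun]
      ring
  | zero => simp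
  | add x y _ _ hx hy => rw [map_add]; exact Submodule.add_mem _ hx hy
  | smul c x _ hx => rw [map_smul]; exact Submodule.smul_mem _ c hx

theorem coordMul_comm : coordMul h 0 * coordMul h 1 = coordMul h 1 * coordMul h 0 := by
  ext1 u
  apply Subtype.ext
  apply Lp.ext
  simp only [Module.End.mul_apply]
  filter_upwards [coordMul_ae h 0 u, coordMul_ae h 1 u, coordMul_ae h 0 (coordMul h 1 u),
    coordMul_ae h 1 (coordMul h 0 u)] with z h1 h2 h3 h4
  rw [h3, h4, h1, h2]
  ring

theorem inner_coordMul (i : Fin 2) (u w : polySpace h) :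
    inner ℝ (coordMul h i u) w = inner ℝ u (coordMul h i w) := by
  rw [Submodule.coe_inner, Submodule.coe_inner, L2.inner_def, L2.inner_def]
  refine integral_congr_ae ?_
  filter_upwards [coordMul_ae h i u, coordMul_ae h i w] with z h1 h2
  rw [h1, h2]
  simp
  ring

/-- On a chaos space, multiplication by a coordinate only reaches the two neighbouring degrees:
it raises the degree by at most one, and by symmetry it lowers it by at most one. -/
theorem coordMul_eq_sum_proj (i : Fin 2) {n : ℤ} {u : polySpace h} (hu : u ∈ chaos h n) :
    coordMul h i u = (chaos h (n + -1)).starProjection (coordMul h i u)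
      + (chaos h (n + 0)).starProjection (coordMul h i u)
      + (chaos h (n + 1)).starProjection (coordMul h i u) := by
  rw [← sub_eq_zero]
  refine eq_zero_of_forall_inner_chaos h fun k v hv => ?_
  rw [inner_sub_left, inner_add_left, inner_add_left, inner_chaos_proj h _ hv,
    inner_chaos_proj h _ hv, inner_chaos_proj h _ hv]
  by_cases hk : k ≤ n - 2
  · have : inner ℝ (coordMul h i u) v = 0 := by
      rw [inner_coordMul]
      exact Submodule.inner_left_of_mem_orthogonal
        (degLE_mono h (by omega) (coordMul_mem_degLE h i hv.1)) hu.2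
    simp [this]
  · by_cases hk2 : n + 2 ≤ k
    · have : inner ℝ (coordMul h i u) v = 0 :=
        Submodule.inner_right_of_mem_orthogonal
          (degLE_mono h (by omega) (coordMul_mem_degLE h i hu.1)) hv.2
      simp [this]
    · obtain rfl | rfl | rfl : k = n + -1 ∨ k = n + 0 ∨ k = n + 1 := by omega
      all_goals simp

/-! ### Homogeneous parts of operators -/

theorem degPart_apply {n k : ℤ} (T : Module.End ℝ (polySpace h)) {u : polySpace h}
    (hu : u ∈ chaos h n) : degPart h k T u = (chaos h (n + k)).starProjection (T u) := by
  change ∑ᶠ m : ℤ, (chaos h (m + k)).starProjection (T ((chaos h m).starProjection u)) = _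
  rw [finsum_eq_single _ n, chaos_proj_self h hu]
  intro m hm
  rw [chaos_proj_eq_zero h (Ne.symm hm) hu, map_zero, map_zero]

/-- The homogeneous part of degree `k`, as a linear map in the operator. -/
noncomputable def degPartLin (k : ℤ) :
    Module.End ℝ (polySpace h) →ₗ[ℝ] Module.End ℝ (polySpace h) where
  toFun := degPart h k
  map_add' A B := end_ext h fun n u hu => by
    rw [LinearMap.add_apply, degPart_apply h _ hu, degPart_apply h _ hu, degPart_apply h _ hu,
      LinearMap.add_apply, map_add]
  map_smul' c A := end_ext h fun n u hu => by
    rw [RingHom.id_apply, LinearMap.smul_apply, degPart_apply h _ hu, degPart_apply h _ hu,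
      LinearMap.smul_apply, map_smul]

/-- The operator `A` shifts the chaos degree by `k`. -/
def IsHomog (k : ℤ) (A : Module.End ℝ (polySpace h)) : Prop :=
  ∀ n : ℤ, ∀ u ∈ chaos h n, A u ∈ chaos h (n + k)

variable {h}

theorem IsHomog.mul {j k : ℤ} {A B : Module.End ℝ (polySpace h)} (hA : IsHomog h j A)
    (hB : IsHomog h k B) : IsHomog h (j + k) (A * B) := fun n u hu => by
  have := hA _ _ (hB n u hu)
  rwa [add_assoc, add_comm k j] at this

theorem IsHomog.add {k : ℤ} {A B : Module.End ℝ (polySpace h)} (hA : IsHomog h k A)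
    (hB : IsHomog h k B) : IsHomog h k (A + B) := fun n u hu =>
  Submodule.add_mem _ (hA n u hu) (hB n u hu)

theorem IsHomog.sub {k : ℤ} {A B : Module.End ℝ (polySpace h)} (hA : IsHomog h k A)
    (hB : IsHomog h k B) : IsHomog h k (A - B) := fun n u hu =>
  Submodule.sub_mem _ (hA n u hu) (hB n u hu)

theorem IsHomog.smul {k : ℤ} {A : Module.End ℝ (polySpace h)} (c : ℝ) (hA : IsHomog h k A) :
    IsHomog h k (c • A) := fun n u hu => Submodule.smul_mem _ c (hA n u hu)

theorem IsHomog.commutator {j k : ℤ} {A B : Module.End ℝ (polySpace h)} (hA : IsHomog h j A)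
    (hB : IsHomog h k B) : IsHomog h (j + k) (A * B - B * A) :=
  (hA.mul hB).sub (add_comm j k ▸ hB.mul hA)

theorem isHomog_one : IsHomog h 0 1 := fun n u hu => by simpa using hu

/-- Taking the part of degree `j` keeps operators of degree `j` and kills all other homogeneous
operators; operator identities can therefore be compared degree by degree. -/
theorem degPartLin_of_isHomog {k : ℤ} {A : Module.End ℝ (polySpace h)} (hA : IsHomog h k A)
    (j : ℤ) : degPartLin h j A = if j = k then A else 0 := by
  refine end_ext h fun n u hu => ?_
  change degPart h j A u = _
  rw [degPart_apply h _ hu]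
  split_ifs with hjk
  · subst hjk; exact chaos_proj_self h (hA n u hu)
  · exact chaos_proj_eq_zero h (by omega) (hA n u hu)

variable (h)

theorem isHomog_apc (i : Fin 2) (ε : ℤ) : IsHomog h ε (apc h i ε) := fun n u hu => by
  rw [apc, degPart_apply h _ hu]
  exact chaos_proj_mem h _ _

theorem coordMul_eq_add_apc (i : Fin 2) :
    coordMul h i = apc h i (-1) + apc h i 0 + apc h i 1 := by
  refine end_ext h fun n u hu => ?_
  simp only [LinearMap.add_apply, apc, degPart_apply h _ hu]
  exact coordMul_eq_sum_proj h i hu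

/-- Creation and annihilation operators are adjoint, preservation operators are symmetric. -/
theorem inner_apc (i : Fin 2) (ε : ℤ) (u w : polySpace h) :
    inner ℝ (apc h i ε u) w = inner ℝ u (apc h i (-ε) w) := by
  have hu : u ∈ ⨆ n, chaos h n := by rw [iSup_chaos]; trivial
  induction hu using Submodule.iSup_induction' with
  | mem n u hu =>
    have hw : w ∈ ⨆ n, chaos h n := by rw [iSup_chaos]; trivial
    induction hw using Submodule.iSup_induction' with
    | mem m w hw =>
      rw [apc, apc, degPart_apply h _ hu, degPart_apply h _ hw, inner_chaos_proj h _ hw,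
        real_inner_comm ((chaos h (m + -ε)).starProjection (coordMul h i w)) u,
        inner_chaos_proj h _ hu, inner_coordMul, real_inner_comm]
      exact if_congr (by omega) rfl rfl
    | zero => simp
    | add x y _ _ hx hy => rw [map_add, inner_add_right, inner_add_right, hx, hy]
  | zero => simp
  | add x y _ _ hx hy => rw [map_add, inner_add_left, inner_add_left, hx, hy]

end Grading

/-! ### Ladder operators of linear forms and their commutators -/

section Closure

variable {μ : Measure (ℝ × ℝ)} (h : HasFiniteMoments μ)

/-- The operator-valued linear form `v ↦ v.1 • A + v.2 • B` on the plane. -/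
def operatorForm {V : Type*} [AddCommGroup V] [Module ℝ V] (A B : Module.End ℝ V) :
    (ℝ × ℝ) →ₗ[ℝ] Module.End ℝ V :=
  (LinearMap.fst ℝ ℝ ℝ).smulRight A + (LinearMap.snd ℝ ℝ ℝ).smulRight B

theorem operatorForm_apply {V : Type*} [AddCommGroup V] [Module ℝ V] (A B : Module.End ℝ V)
    (v : ℝ × ℝ) : operatorForm A B v = v.1 • A + v.2 • B := rfl

/-- The annihilation, preservation and creation operators (`ε = -1, 0, 1`) generated by
multiplication by the linear form `z ↦ v.1 * z.1 + v.2 * z.2`. -/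
noncomputable def ladder (ε : ℤ) : (ℝ × ℝ) →ₗ[ℝ] Module.End ℝ (polySpace h) :=
  operatorForm (apc h 0 ε) (apc h 1 ε)

/-- Multiplication by the linear form `z ↦ v.1 * z.1 + v.2 * z.2`. -/
noncomputable def formMul : (ℝ × ℝ) →ₗ[ℝ] Module.End ℝ (polySpace h) :=
  operatorForm (coordMul h 0) (coordMul h 1)

theorem isHomog_ladder (ε : ℤ) (v : ℝ × ℝ) : IsHomog h ε (ladder h ε v) :=
  ((isHomog_apc h 0 ε).smul _).add ((isHomog_apc h 1 ε).smul _)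

theorem formMul_eq (v : ℝ × ℝ) :
    formMul h v = ladder h (-1) v + ladder h 0 v + ladder h 1 v := by
  simp only [formMul, ladder, operatorForm_apply, coordMul_eq_add_apc]
  module

theorem formMul_comm (v w : ℝ × ℝ) : formMul h v * formMul h w = formMul h w * formMul h v := by
  simp only [formMul, operatorForm_apply, mul_add, add_mul, smul_mul_smul_comm, coordMul_comm]
  module

theorem inner_ladder (ε : ℤ) (v : ℝ × ℝ) (u w : polySpace h) :
    inner ℝ (ladder h ε v u) w = inner ℝ u (ladder h (-ε) v w) := by
  simp only [ladder, operatorForm_apply, LinearMap.add_apply, LinearMap.smul_apply,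
    inner_add_left, inner_add_right, real_inner_smul_left, real_inner_smul_right, inner_apc]

/-- The homogeneous parts of the identity `[X_v, X_w] = 0`. -/
theorem degPartLin_commutator (v w : ℝ × ℝ) (k : ℤ) :
    ∑ i ∈ {-1, 0, 1}, ∑ j ∈ {-1, 0, 1}, (if k = i + j then
      ladder h i v * ladder h j w - ladder h j w * ladder h i v else 0) = 0 := by
  have h0 : formMul h v * formMul h w - formMul h w * formMul h v
      = ∑ i ∈ {-1, 0, 1}, ∑ j ∈ {-1, 0, 1},
        (ladder h i v * ladder h j w - ladder h j w * ladder h i v) := by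
    simp [formMul_eq]
    noncomm_ring
  rw [formMul_comm, sub_self] at h0
  have h1 := congrArg (degPartLin h k) h0
  rw [map_zero, map_sum] at h1
  refine Eq.trans ?_ h1.symm
  refine Finset.sum_congr rfl fun i _ => ?_
  rw [map_sum]
  refine Finset.sum_congr rfl fun j _ => ?_
  rw [degPartLin_of_isHomog ((isHomog_ladder h i v).commutator (isHomog_ladder h j w))]

theorem ladder_one_comm (v w : ℝ × ℝ) :
    ladder h 1 v * ladder h 1 w = ladder h 1 w * ladder h 1 v := by
  simpa [sub_eq_zero] using degPartLin_commutator h v w 2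

theorem ladder_zero_one_comm (v w : ℝ × ℝ) :
    ladder h 0 v * ladder h 1 w - ladder h 1 w * ladder h 0 v
      = ladder h 0 w * ladder h 1 v - ladder h 1 v * ladder h 0 w := by
  have := degPartLin_commutator h v w 1
  simp at this
  rw [← sub_eq_zero, ← this]
  abel

theorem ladder_degree_zero (v w : ℝ × ℝ) :
    (ladder h (-1) v * ladder h 1 w - ladder h 1 w * ladder h (-1) v)
      + (ladder h 0 v * ladder h 0 w - ladder h 0 w * ladder h 0 v)
      + (ladder h 1 v * ladder h (-1) w - ladder h (-1) w * ladder h 1 v) = 0 := by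
  have := degPartLin_commutator h v w 0
  simp at this
  rw [← this]
  abel

theorem ladder_mem_apcSpan {ε : ℤ} (hε : ε = -1 ∨ ε = 0 ∨ ε = 1) (v : ℝ × ℝ) :
    ladder h ε v ∈ apcSpan h := by
  refine Submodule.add_mem _ (Submodule.smul_mem _ _ (Submodule.subset_span ?_))
    (Submodule.smul_mem _ _ (Submodule.subset_span ?_)) <;>
  · rcases hε with rfl | rfl | rfl <;> simp

/-- An element of `apcSpan h` is `c • 1` plus a ladder operator of each degree. -/
theorem exists_of_mem_apcSpan {A : Module.End ℝ (polySpace h)} (hA : A ∈ apcSpan h) :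
    ∃ (c : ℝ) (p q r : ℝ × ℝ), A = c • 1 + ladder h (-1) p + ladder h 0 q + ladder h 1 r := by
  simp only [apcSpan, Submodule.mem_span_insert, Submodule.mem_span_singleton] at hA
  obtain ⟨c, _, ⟨p1, _, ⟨q1, _, ⟨r1, _, ⟨p2, _, ⟨q2, _, ⟨r2, rfl⟩, rfl⟩, rfl⟩, rfl⟩, rfl⟩, rfl⟩,
    rfl⟩ := hA
  refine ⟨c, (p1, p2), (q1, q2), (r1, r2), ?_⟩
  simp only [ladder, operatorForm_apply]
  abel

/-- A homogeneous element of `apcSpan h` only involves the generators of its own degree. -/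
theorem exists_of_mem_apcSpan_of_isHomog {A : Module.End ℝ (polySpace h)} (hA : A ∈ apcSpan h) :
    (IsHomog h 1 A → ∃ r, A = ladder h 1 r) ∧
    (IsHomog h 0 A → ∃ (c : ℝ) (q : ℝ × ℝ), A = c • 1 + ladder h 0 q) := by
  obtain ⟨c, p, q, r, rfl⟩ := exists_of_mem_apcSpan h hA
  have key : ∀ k : ℤ, IsHomog h k (c • 1 + ladder h (-1) p + ladder h 0 q + ladder h 1 r) →
      c • 1 + ladder h (-1) p + ladder h 0 q + ladder h 1 r = c • (if k = 0 then 1 else 0)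
        + (if k = -1 then ladder h (-1) p else 0) + (if k = 0 then ladder h 0 q else 0)
        + (if k = 1 then ladder h 1 r else 0) := by
    intro k hk
    have h1 := degPartLin_of_isHomog hk k
    rw [if_pos rfl, map_add, map_add, map_add, map_smul, degPartLin_of_isHomog isHomog_one,
      degPartLin_of_isHomog (isHomog_ladder h (-1) p),
      degPartLin_of_isHomog (isHomog_ladder h 0 q),
      degPartLin_of_isHomog (isHomog_ladder h 1 r)] at h1
    exact h1.symm
  exact ⟨fun h1 => ⟨r, by simpa using key 1 h1⟩, fun h0 => ⟨c, q, by simpa using key 0 h0⟩⟩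

/-! ### The vacuum vector -/

/-- The class of the constant function `1`. -/
noncomputable def vac : polySpace h := ⟨monomialL2 h 0 0, Submodule.subset_span ⟨0, 0, rfl⟩⟩

theorem vac_ae : (vac h : Lp ℝ 2 μ) =ᵐ[μ] fun _ => 1 := by
  filter_upwards [(h.memLp 0 0).coeFn_toLp] with z hz
  simpa [vac, monomialL2] using hz

theorem vac_mem_chaos : vac h ∈ chaos h 0 := by
  refine ⟨Submodule.subset_span ⟨0, 0, by simp, rfl⟩, ?_⟩
  rw [degLE_of_neg h (by omega)]
  simp

theorem inner_vac (u : polySpace h) : inner ℝ u (vac h) = ∫ z, (u : Lp ℝ 2 μ) z ∂μ := by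
  rw [Submodule.coe_inner, L2.inner_def]
  refine integral_congr_ae ?_
  filter_upwards [vac_ae h] with z hz
  simp [hz]

theorem inner_vac_vac [IsProbabilityMeasure μ] : inner ℝ (vac h) (vac h) = 1 := by
  rw [inner_vac, integral_congr_ae (vac_ae h)]
  simp

/-- The chaos space of degree `0` consists of the constants. -/
theorem exists_smul_vac {u : polySpace h} (hu : u ∈ chaos h 0) : ∃ c : ℝ, u = c • vac h := by
  have h1 : degLE h 0 ≤ Submodule.span ℝ {vac h} := by
    refine Submodule.span_le.2 ?_
    rintro g ⟨a, b, hab, hg⟩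
    obtain ⟨rfl, rfl⟩ : a = 0 ∧ b = 0 := by omega
    exact Submodule.mem_span_singleton.2 ⟨1, Subtype.ext (by rw [one_smul, hg]; rfl)⟩
  obtain ⟨c, hc⟩ := Submodule.mem_span_singleton.1 (h1 hu.1)
  exact ⟨c, hc.symm⟩

theorem ladder_neg_one_vac (v : ℝ × ℝ) : ladder h (-1) v (vac h) = 0 := by
  have := isHomog_ladder h (-1) v 0 _ (vac_mem_chaos h)
  rwa [chaos_of_neg h (by omega), Submodule.mem_bot] at this

/-- The mean of the linear form `v`, read off from the preservation operator. -/
noncomputable def formMean (v : ℝ × ℝ) : ℝ := inner ℝ (ladder h 0 v (vac h)) (vac h)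

theorem ladder_zero_vac [IsProbabilityMeasure μ] (v : ℝ × ℝ) :
    ladder h 0 v (vac h) = formMean h v • vac h := by
  obtain ⟨c, hc⟩ := exists_smul_vac h (isHomog_ladder h 0 v 0 _ (vac_mem_chaos h))
  have h1 : inner ℝ (c • vac h) (vac h) = c * inner ℝ (vac h) (vac h) :=
    real_inner_smul_left (F := polySpace h) _ _ _
  rw [formMean, hc, h1, inner_vac_vac, mul_one]

/-- The preservation operators, normalized so as to annihilate the vacuum. -/
noncomputable def centered : (ℝ × ℝ) →ₗ[ℝ] Module.End ℝ (polySpace h) where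
  toFun v := ladder h 0 v - formMean h v • 1
  map_add' v w := by
    simp only [formMean, map_add, LinearMap.add_apply, inner_add_left]
    module
  map_smul' c v := by
    simp only [formMean, map_smul, LinearMap.smul_apply, real_inner_smul_left, RingHom.id_apply]
    module

theorem centered_apply (v : ℝ × ℝ) : centered h v = ladder h 0 v - formMean h v • 1 := rfl

theorem formMul_ae (v : ℝ × ℝ) (u : polySpace h) :
    (formMul h v u : Lp ℝ 2 μ) =ᵐ[μ] fun z => (v.1 * z.1 + v.2 * z.2) * (u : Lp ℝ 2 μ) z := by
  simp only [formMul, operatorForm_apply, LinearMap.add_apply, LinearMap.smul_apply,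
    Submodule.coe_add, Submodule.coe_smul]
  filter_upwards [coordMul_ae h 0 u, coordMul_ae h 1 u,
    Lp.coeFn_add (v.1 • (coordMul h 0 u : Lp ℝ 2 μ)) (v.2 • (coordMul h 1 u : Lp ℝ 2 μ)),
    Lp.coeFn_smul v.1 (coordMul h 0 u : Lp ℝ 2 μ),
    Lp.coeFn_smul v.2 (coordMul h 1 u : Lp ℝ 2 μ)] with z h1 h2 h3 h4 h5
  rw [h3, Pi.add_apply, h4, h5, Pi.smul_apply, Pi.smul_apply, h1, h2]
  simp [coordFun]
  ring

/-- If `μ` is carried by no line, the creation operators act injectively on the vacuum. -/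
theorem eq_zero_of_ladder_one_vac [IsProbabilityMeasure μ]
    (hline : ∀ l : Set (ℝ × ℝ), IsLine l → ¬ IsSupportedOn μ l)
    {v : ℝ × ℝ} (hv : ladder h 1 v (vac h) = 0) : v = 0 := by
  by_contra hne
  refine hline {z | v.1 * z.1 + v.2 * z.2 = formMean h v} ⟨v.1, v.2, _, ?_, rfl⟩ ?_
  · by_contra hle
    exact hne (Prod.ext (by simp; nlinarith [sq_nonneg v.1, sq_nonneg v.2])
      (by simp; nlinarith [sq_nonneg v.1, sq_nonneg v.2]))
  · have h1 : formMul h v (vac h) = formMean h v • vac h := by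
      rw [formMul_eq, LinearMap.add_apply, LinearMap.add_apply, ladder_neg_one_vac, hv,
        ladder_zero_vac, zero_add, add_zero]
    have h2 := formMul_ae h v (vac h)
    rw [h1] at h2
    have h3 : ∀ᵐ z ∂μ, v.1 * z.1 + v.2 * z.2 = formMean h v := by
      filter_upwards [h2, vac_ae h, Lp.coeFn_smul (formMean h v) (vac h : Lp ℝ 2 μ)]
        with z h2 h3 h4
      rw [Submodule.coe_smul, h4, Pi.smul_apply, h3] at h2
      simpa using h2.symm
    exact h3

end Closure

/-! ### Splitting of the Lie algebra -/

section Abstract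

/-- The rotation diagonalizing a symmetric `2 × 2` matrix with off-diagonal entry `P` and difference
`Q` of the diagonal entries. -/
theorem exists_half_rotation (P Q : ℝ) :
    ∃ x y : ℝ, x ^ 2 + y ^ 2 = 1 ∧ P * (x ^ 2 - y ^ 2) = Q * (x * y) := by
  -- twice the rotation angle is the argument of `Q / 2 + i P`
  set z : ℂ := ⟨Q / 2, P⟩
  set θ := z.arg / 2 with hθ
  have h2 : 2 * θ = z.arg := by rw [hθ]; ring
  have hc : ‖z‖ * Real.cos (2 * θ) = Q / 2 := by rw [h2]; exact Complex.norm_mul_cos_arg z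
  have hs : ‖z‖ * Real.sin (2 * θ) = P := by rw [h2]; exact Complex.norm_mul_sin_arg z
  refine ⟨Real.cos θ, Real.sin θ, Real.cos_sq_add_sin_sq θ, ?_⟩
  have h3 : Real.cos θ ^ 2 - Real.sin θ ^ 2 = Real.cos (2 * θ) := (Real.cos_two_mul' θ).symm
  have h4 : Real.cos θ * Real.sin θ = Real.sin (2 * θ) / 2 := by rw [Real.sin_two_mul]; ring
  rw [h3, h4]
  linear_combination (-Real.cos (2 * θ)) * hs + Real.sin (2 * θ) * hc

/-- The rotation with cosine `x` and sine `y` diagonalizes a symmetric `2 × 2` matrix with diagonal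
`p, r` and off-diagonal entry `q` iff `q (x² - y²) = (p - r) x y`. When the pairs `(q, p - r)` of
two matrices are parallel, which expresses that the matrices commute, one rotation serves both. -/
theorem exists_common_rotation {P₁ Q₁ P₂ Q₂ : ℝ} (hpar : P₁ * Q₂ = P₂ * Q₁) :
    ∃ x y : ℝ, x ^ 2 + y ^ 2 = 1 ∧ P₁ * (x ^ 2 - y ^ 2) = Q₁ * (x * y) ∧
      P₂ * (x ^ 2 - y ^ 2) = Q₂ * (x * y) := by
  by_cases h0 : P₁ = 0 ∧ Q₁ = 0
  · obtain ⟨x, y, h1, h2⟩ := exists_half_rotation P₂ Q₂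
    exact ⟨x, y, h1, by rw [h0.1, h0.2]; ring, h2⟩
  · obtain ⟨x, y, h1, h2⟩ := exists_half_rotation P₁ Q₁
    refine ⟨x, y, h1, h2, ?_⟩
    by_cases hP : P₁ = 0
    · have hQ : Q₁ ≠ 0 := fun hQ => h0 ⟨hP, hQ⟩
      apply mul_left_cancel₀ hQ
      linear_combination (-(x ^ 2 - y ^ 2)) * hpar + Q₂ * h2
    · apply mul_left_cancel₀ hP
      linear_combination P₂ * h2 - x * y * hpar

variable {V : Type*} [NormedAddCommGroup V] [InnerProductSpace ℝ V]

theorem exists_orthonormal_pair {η : (ℝ × ℝ) →ₗ[ℝ] V} (hη : Function.Injective η) :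
    ∃ f₁ f₂ : ℝ × ℝ, inner ℝ (η f₁) (η f₁) = 1 ∧ inner ℝ (η f₂) (η f₂) = 1 ∧
      inner ℝ (η f₁) (η f₂) = 0 ∧
      ∀ u, η u = inner ℝ (η f₁) (η u) • η f₁ + inner ℝ (η f₂) (η u) • η f₂ := by
  have hfin : Module.finrank ℝ (LinearMap.range η) = 2 := by
    rw [LinearMap.finrank_range_of_inj hη]
    simp
  let b := (stdOrthonormalBasis ℝ (LinearMap.range η)).reindex (finCongr hfin)
  obtain ⟨f₁, hf₁⟩ := (b 0).2
  obtain ⟨f₂, hf₂⟩ := (b 1).2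
  have ho : ∀ i j, inner ℝ (b i : V) (b j : V) = if i = j then (1 : ℝ) else 0 := fun i j => by
    rw [← Submodule.coe_inner]
    exact orthonormal_iff_ite.1 b.orthonormal i j
  refine ⟨f₁, f₂, ?_, ?_, ?_, fun u => ?_⟩
  · rw [hf₁, ho]; simp
  · rw [hf₂, ho]; simp
  · rw [hf₁, hf₂, ho]; simp
  · have h1 := congrArg Subtype.val (b.sum_repr' ⟨η u, u, rfl⟩)
    rw [Fin.sum_univ_two] at h1
    rw [hf₁, hf₂]
    exact h1.symm

/-- Annihilation operators `Am v`, centered preservation operators `N v` and creation operators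
`Ap v`, depending linearly on a vector `v` of the plane, that span a Lie algebra together with the
identity and whose sums `Am v + N v + Ap v` commute, together with a vacuum vector `Ω`. -/
structure LadderSystem (Am N Ap : (ℝ × ℝ) →ₗ[ℝ] Module.End ℝ V) (Ω : V) : Prop where
  am_vac : ∀ v, Am v Ω = 0
  n_vac : ∀ v, N v Ω = 0
  inner_vac : inner ℝ Ω Ω = (1 : ℝ)
  inner_ap : ∀ v (u w : V), inner ℝ (Ap v u) w = inner ℝ u (Am v w)
  inner_n : ∀ v (u w : V), inner ℝ (N v u) w = inner ℝ u (N v w)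
  ap_comm : ∀ v w, Ap v * Ap w = Ap w * Ap v
  n_ap_comm : ∀ v w, N v * Ap w - Ap w * N v = N w * Ap v - Ap v * N w
  degree_zero : ∀ v w, (Am v * Ap w - Ap w * Am v) + (N v * N w - N w * N v)
    + (Ap v * Am w - Am w * Ap v) = 0
  exists_n_ap : ∀ v w, ∃ u, N v * Ap w - Ap w * N v = Ap u
  exists_am_ap : ∀ v w, ∃ (c : ℝ) (q : ℝ × ℝ), Am v * Ap w - Ap w * Am v = c • 1 + N q
  injective : ∀ v, Ap v Ω = 0 → v = 0

namespace LadderSystem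

variable {Am N Ap : (ℝ × ℝ) →ₗ[ℝ] Module.End ℝ V} {Ω : V} (hL : LadderSystem Am N Ap Ω)

include hL

theorem n_ap_vac_comm (v w : ℝ × ℝ) : N v (Ap w Ω) = N w (Ap v Ω) := by
  have := LinearMap.congr_fun (hL.n_ap_comm v w) Ω
  simpa [hL.n_vac] using this

/-- The operators `Am v * Ap w - Ap w * Am v` are self-adjoint, hence symmetric in `v`, `w`. -/
theorem am_ap_symm (v w : ℝ × ℝ) : Am v * Ap w - Ap w * Am v = Am w * Ap v - Ap v * Am w := by
  obtain ⟨c, q, hq⟩ := hL.exists_am_ap v w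
  ext1 u
  refine ext_inner_right ℝ fun x => ?_
  have h1 : inner ℝ ((Am v * Ap w - Ap w * Am v) u) x
      = inner ℝ u ((Am v * Ap w - Ap w * Am v) x) := by
    rw [hq]
    simp [inner_add_left, inner_add_right, real_inner_smul_left, real_inner_smul_right, hL.inner_n]
  have h2 : ∀ v u x, inner ℝ (Am v u) x = inner ℝ u (Ap v x) := fun v u x => by
    rw [real_inner_comm, ← hL.inner_ap, real_inner_comm]
  rw [h1]
  simp [inner_sub_left, inner_sub_right, hL.inner_ap, h2]

theorem n_comm (v w : ℝ × ℝ) : N v * N w = N w * N v := by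
  have h1 := hL.degree_zero v w
  rw [hL.am_ap_symm v w] at h1
  rw [← sub_eq_zero, ← h1]
  abel

/-- The preservation operators have a common orthonormal eigenbasis `e` in the first chaos, and
the product `v, w ↦ [N v, Ap w]` is diagonal in it: by commutativity, `N v (Ap w Ω)` is symmetric
in `v`, `w`. -/
theorem exists_diagonal : ∃ (e : Fin 2 → ℝ × ℝ) (α : Fin 2 → ℝ),
    (∀ i j, inner ℝ (Ap (e i) Ω) (Ap (e j) Ω) = if i = j then (1 : ℝ) else 0) ∧
    (∀ u, u = inner ℝ (Ap (e 0) Ω) (Ap u Ω) • e 0 + inner ℝ (Ap (e 1) Ω) (Ap u Ω) • e 1) ∧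
    ∀ i j, N (e i) * Ap (e j) - Ap (e j) * N (e i) = if i = j then α i • Ap (e i) else 0 := by
  let η : (ℝ × ℝ) →ₗ[ℝ] V := Ap.flip Ω
  have hηa : ∀ v, Ap v Ω = η v := fun v => rfl
  have hinj : Function.Injective η := (injective_iff_map_eq_zero η).2 hL.injective
  obtain ⟨f₁, f₂, h11, h22, h12, hexp⟩ := exists_orthonormal_pair hinj
  have h21 : inner ℝ (η f₂) (η f₁) = 0 := by rw [real_inner_comm, h12]
  have hNe : ∀ v w, ∃ u, N v (η w) = η u := fun v w => by
    obtain ⟨u, hu⟩ := hL.exists_n_ap v w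
    refine ⟨u, ?_⟩
    change N v (Ap w Ω) = Ap u Ω
    simpa [hL.n_vac] using LinearMap.congr_fun hu Ω
  have hN : ∀ v w, N v (η w) = inner ℝ (N v (η w)) (η f₁) • η f₁
      + inner ℝ (N v (η w)) (η f₂) • η f₂ := fun v w => by
    obtain ⟨u, hu⟩ := hNe v w
    rw [hu, real_inner_comm (η f₁), real_inner_comm (η f₂)]
    exact hexp u
  have hcomm : ∀ v w, N v (η w) = N w (η v) := hL.n_ap_vac_comm
  -- `⟪N u (η v), η w⟫` is a symmetric trilinear form, with components `a, b, c, d`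
  obtain ⟨a, ha⟩ : ∃ a, a = inner ℝ (N f₁ (η f₁)) (η f₁) := ⟨_, rfl⟩
  obtain ⟨b, hb⟩ : ∃ b, b = inner ℝ (N f₁ (η f₁)) (η f₂) := ⟨_, rfl⟩
  obtain ⟨c, hc⟩ : ∃ c, c = inner ℝ (N f₁ (η f₂)) (η f₂) := ⟨_, rfl⟩
  obtain ⟨d, hd⟩ : ∃ d, d = inner ℝ (N f₂ (η f₂)) (η f₂) := ⟨_, rfl⟩
  have N11 : N f₁ (η f₁) = a • η f₁ + b • η f₂ := by rw [ha, hb]; exact hN _ _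
  have N12 : N f₁ (η f₂) = b • η f₁ + c • η f₂ := by
    have : inner ℝ (N f₁ (η f₂)) (η f₁) = b := by rw [hL.inner_n, real_inner_comm, hb]
    rw [hc, ← this]; exact hN _ _
  have N22 : N f₂ (η f₂) = c • η f₁ + d • η f₂ := by
    have : inner ℝ (N f₂ (η f₂)) (η f₁) = c := by
      rw [hL.inner_n, hcomm f₂ f₁, real_inner_comm, hc]
    rw [hd, ← this]; exact hN _ _
  have N21 : N f₂ (η f₁) = b • η f₁ + c • η f₂ := by rw [hcomm f₂ f₁, N12]
  -- the operators `N f₁` and `N f₂` commute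
  have hrel : b * (b - d) = c * (a - c) := by
    have h1 : inner ℝ (N f₂ (η f₁)) (N f₁ (η f₂)) = inner ℝ (N f₁ (η f₁)) (N f₂ (η f₂)) := by
      rw [hL.inner_n, hL.inner_n, ← Module.End.mul_apply, ← Module.End.mul_apply, hL.n_comm]
    rw [N21, N12, N11, N22] at h1
    simp only [inner_add_left, inner_add_right, real_inner_smul_left, real_inner_smul_right,
      h11, h12, h21, h22] at h1
    linear_combination h1
  obtain ⟨x, y, hxy, hr1, hr2⟩ := exists_common_rotation hrel
  have hNzero : N (x • f₁ + y • f₂) (η (-y • f₁ + x • f₂)) = 0 := by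
    have : N (x • f₁ + y • f₂) (η (-y • f₁ + x • f₂))
        = (b * (x ^ 2 - y ^ 2) - (a - c) * (x * y)) • η f₁
          + (c * (x ^ 2 - y ^ 2) - (b - d) * (x * y)) • η f₂ := by
      simp only [map_add, map_smul, LinearMap.add_apply, LinearMap.smul_apply, N11, N12, N21, N22]
      module
    rw [this, hr1, hr2]
    simp
  obtain ⟨e₁, he₁⟩ : ∃ e, e = x • f₁ + y • f₂ := ⟨_, rfl⟩
  obtain ⟨e₂, he₂⟩ : ∃ e, e = -y • f₁ + x • f₂ := ⟨_, rfl⟩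
  rw [← he₁, ← he₂] at hNzero
  have hNzero' : N e₂ (η e₁) = 0 := by rw [hcomm, hNzero]
  have g11 : inner ℝ (η e₁) (η e₁) = 1 := by
    rw [he₁]
    simp only [map_add, map_smul, inner_add_left, inner_add_right, real_inner_smul_left,
      real_inner_smul_right, h11, h12, h21, h22]
    linear_combination hxy
  have g22 : inner ℝ (η e₂) (η e₂) = 1 := by
    rw [he₂]
    simp only [map_add, map_smul, inner_add_left, inner_add_right, real_inner_smul_left,
      real_inner_smul_right, h11, h12, h21, h22]
    linear_combination hxy
  have g12 : inner ℝ (η e₁) (η e₂) = 0 := by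
    rw [he₁, he₂]
    simp only [map_add, map_smul, inner_add_left, inner_add_right, real_inner_smul_left,
      real_inner_smul_right, h11, h12, h21, h22]
    ring
  have g21 : inner ℝ (η e₂) (η e₁) = 0 := by rw [real_inner_comm, g12]
  have hexp' : ∀ u, u = inner ℝ (η e₁) (η u) • e₁ + inner ℝ (η e₂) (η u) • e₂ := fun u => by
    apply hinj
    conv_lhs => rw [hexp u]
    rw [he₁, he₂]
    simp only [map_add, map_smul, inner_add_left, real_inner_smul_left]
    match_scalars
    · linear_combination (-(inner ℝ (η f₁) (η u))) * hxy
    · linear_combination (-(inner ℝ (η f₂) (η u))) * hxy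
  have hη' : ∀ u, η u = inner ℝ (η e₁) (η u) • η e₁ + inner ℝ (η e₂) (η u) • η e₂ := fun u => by
    rw [← map_smul, ← map_smul, ← map_add, ← hexp' u]
  have D1 : N e₁ (η e₁) = inner ℝ (η e₁) (N e₁ (η e₁)) • η e₁ := by
    obtain ⟨u, hu⟩ := hNe e₁ e₁
    have h0 : inner ℝ (η e₂) (η u) = 0 := by
      rw [← hu, ← hL.inner_n, hNzero, inner_zero_left]
    rw [hu]
    conv_lhs => rw [hη' u, h0, zero_smul, add_zero]
  have D2 : N e₂ (η e₂) = inner ℝ (η e₂) (N e₂ (η e₂)) • η e₂ := by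
    obtain ⟨u, hu⟩ := hNe e₂ e₂
    have h0 : inner ℝ (η e₁) (η u) = 0 := by
      rw [← hu, ← hL.inner_n, hNzero', inner_zero_left]
    rw [hu]
    conv_lhs => rw [hη' u, h0, zero_smul, zero_add]
  -- by injectivity on the vacuum, commutators `[N v, Ap w]` are known from their value there
  have lift : ∀ v w u, N v (η w) = η u → N v * Ap w - Ap w * N v = Ap u := fun v w u hu => by
    obtain ⟨u', hu'⟩ := hL.exists_n_ap v w
    have := LinearMap.congr_fun hu' Ω
    rw [LinearMap.sub_apply, Module.End.mul_apply, Module.End.mul_apply, hL.n_vac, map_zero,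
      sub_zero, hηa, hηa, hu] at this
    rw [hu', hinj this]
  refine ⟨![e₁, e₂], ![inner ℝ (η e₁) (N e₁ (η e₁)), inner ℝ (η e₂) (N e₂ (η e₂))], ?_, ?_, ?_⟩
  · exact Fin.forall_fin_two.2 ⟨Fin.forall_fin_two.2 ⟨g11, g12⟩, Fin.forall_fin_two.2 ⟨g21, g22⟩⟩
  · intro u
    simpa [hηa] using hexp' u
  · intro i j
    fin_cases i <;> fin_cases j
    · simpa using lift e₁ e₁ _ (D1.trans (map_smul η _ _).symm)
    · simpa using lift e₁ e₂ 0 (hNzero.trans (map_zero η).symm)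
    · simpa using lift e₂ e₁ 0 (hNzero'.trans (map_zero η).symm)
    · simpa using lift e₂ e₂ _ (D2.trans (map_smul η _ _).symm)

/-- The Lie algebra splits in the eigenbasis `e`: the commutators `M = [Am (e i), Ap (e j)]` act on
the creation operators diagonally, and not at all unless all indices agree. -/
theorem exists_splitting : ∃ (e : Fin 2 → ℝ × ℝ) (α G : Fin 2 → ℝ),
    (∀ i j, inner ℝ (Ap (e i) Ω) (Ap (e j) Ω) = if i = j then (1 : ℝ) else 0) ∧
    (∀ i j, N (e i) * Ap (e j) = Ap (e j) * N (e i) + (if i = j then α i else 0) • Ap (e j)) ∧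
    (∀ i j k, (Am (e i) * Ap (e j) - Ap (e j) * Am (e i)) * Ap (e k)
      = Ap (e k) * (Am (e i) * Ap (e j) - Ap (e j) * Am (e i))
        + (if i = j ∧ j = k then G i else 0) • Ap (e k)) ∧
    ∀ i, α i = 0 → G i = 0 := by
  obtain ⟨e, α, horth, hexp, hNA⟩ := hL.exists_diagonal
  choose c q hq using fun i j => hL.exists_am_ap (e i) (e j)
  obtain ⟨g, hg⟩ : ∃ g : Fin 2 → Fin 2 → Fin 2 → ℝ,
    ∀ i j k, g i j k = inner ℝ (Ap (e k) Ω) (Ap (q i j) Ω) * α k := ⟨_, fun _ _ _ => rfl⟩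
  have hM : ∀ i j k, (Am (e i) * Ap (e j) - Ap (e j) * Am (e i)) * Ap (e k)
      - Ap (e k) * (Am (e i) * Ap (e j) - Ap (e j) * Am (e i)) = g i j k • Ap (e k) := by
    intro i j k
    have h1 : (Am (e i) * Ap (e j) - Ap (e j) * Am (e i)) * Ap (e k)
      - Ap (e k) * (Am (e i) * Ap (e j) - Ap (e j) * Am (e i))
      = N (q i j) * Ap (e k) - Ap (e k) * N (q i j) := by
      rw [hq, add_mul, mul_add, smul_one_mul, mul_smul_one]
      abel
    have h2 : N (q i j) * Ap (e k) - Ap (e k) * N (q i j)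
        = inner ℝ (Ap (e 0) Ω) (Ap (q i j) Ω) • (N (e 0) * Ap (e k) - Ap (e k) * N (e 0))
        + inner ℝ (Ap (e 1) Ω) (Ap (q i j) Ω) • (N (e 1) * Ap (e k) - Ap (e k) * N (e 1)) := by
      conv_lhs => rw [hexp (q i j)]
      simp only [map_add, map_smul, add_mul, mul_add, smul_mul_assoc, mul_smul_comm, smul_sub]
      abel
    rw [h1, h2, hNA, hNA, hg]
    fin_cases k <;> simp [mul_smul]
  -- Jacobi identity, as the creation operators commute
  have hjac : ∀ i j k, g i j k • Ap (e k) = g i k j • Ap (e j) := by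
    intro i j k
    rw [← hM, ← hM]
    have := hL.ap_comm (e j) (e k)
    simp only [sub_mul, mul_sub, mul_assoc, this]
    simp only [← mul_assoc, this]
    abel
  have h0 : ∀ i j k, j ≠ k → g i j k = 0 := by
    intro i j k hjk
    have h1 := congrArg (fun w => inner ℝ (Ap (e k) Ω) w) (LinearMap.congr_fun (hjac i j k) Ω)
    simp only [LinearMap.smul_apply, real_inner_smul_right, horth] at h1
    simpa [hjk.symm] using h1
  have hsymm : ∀ i j k, g i j k = g j i k := by
    intro i j k
    have h1 : g i j k • Ap (e k) = g j i k • Ap (e k) := by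
      rw [← hM, ← hM, hL.am_ap_symm]
    have h2 := congrArg (fun w => inner ℝ (Ap (e k) Ω) w) (LinearMap.congr_fun h1 Ω)
    simp only [LinearMap.smul_apply, real_inner_smul_right, horth] at h2
    simpa using h2
  refine ⟨e, α, fun i => g i i i, horth, ?_, ?_, ?_⟩
  · intro i j
    rw [← sub_eq_iff_eq_add', hNA]
    split_ifs with hij
    · rw [hij]
    · rw [zero_smul]
  · intro i j k
    rw [← sub_eq_iff_eq_add', hM]
    congr 1
    split_ifs with hijk
    · rw [← hijk.2, ← hijk.1]
    · by_cases hjk : j = k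
      · rw [hsymm]
        exact h0 _ _ _ fun hik => hijk ⟨hik.trans hjk.symm, hjk⟩
      · exact h0 _ _ _ hjk
  · intro i hi
    simp [hg, hi]

end LadderSystem

end Abstract

/-! ### Meixner polynomials and the action on the vacuum -/

section MeixnerPoly

open Polynomial

/-- The Szegő–Jacobi parameter `ω_n = n (1 + β (n - 1)) = β n² + (1 - β) n`. -/
def meixnerOmega (β : ℝ) (n : ℕ) : ℝ := n * (1 + β * ((n : ℝ) - 1))

/-- The monic polynomials with Szegő–Jacobi parameters `α_n = α n` and `ω_n = n (1 + β (n - 1))`. -/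
noncomputable def meixnerPoly (α β : ℝ) : ℕ → ℝ[X]
  | 0 => 1
  | 1 => X
  | n + 2 => (X - C (α * (n + 1 : ℕ))) * meixnerPoly α β (n + 1)
      - C (meixnerOmega β (n + 1)) * meixnerPoly α β n

theorem X_mul_meixnerPoly (α β : ℝ) (n : ℕ) :
    X * meixnerPoly α β n = meixnerPoly α β (n + 1) + C (α * n) * meixnerPoly α β n
      + C (meixnerOmega β n) * meixnerPoly α β (n - 1) := by
  cases n with
  | zero => simp [meixnerPoly, meixnerOmega]
  | succ n =>
    rw [meixnerPoly, Nat.add_sub_cancel]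
    ring

end MeixnerPoly

section Ladder

open Polynomial

variable {V : Type*} [AddCommGroup V] [Module ℝ V]

/-- If `T` commutes with `A` up to a multiple of `A`, then `A` shifts the eigenvalues of `T`. -/
theorem eigen_pow_of_commutator {T A : Module.End ℝ V} {c l : ℝ} (hTA : T * A = A * T + c • A)
    {u : V} (hu : T u = l • u) (n : ℕ) : T ((A ^ n) u) = (l + c * n) • (A ^ n) u := by
  induction n with
  | zero => simpa using hu
  | succ n ih =>
    have h1 := LinearMap.congr_fun hTA ((A ^ n) u)
    simp only [Module.End.mul_apply, LinearMap.add_apply, LinearMap.smul_apply, ih, map_smul] at h1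
    rw [pow_succ', Module.End.mul_apply, h1]
    push_cast
    module

/-- The polynomials of a raising sequence: if `X` acts on `A ^ n u` by the three-term recurrence
of the polynomials, then the polynomials in `X` create `A ^ n u` from `u`. -/
theorem aeval_meixnerPoly {X A : Module.End ℝ V} {u : V} {α β : ℝ}
    (hX : ∀ n : ℕ, X ((A ^ n) u) = (A ^ (n + 1)) u + (α * n) • (A ^ n) u
      + meixnerOmega β n • (A ^ (n - 1)) u) (n : ℕ) :
    aeval X (meixnerPoly α β n) u = (A ^ n) u := by
  induction n using Nat.twoStepInduction with
  | zero => simp [meixnerPoly]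
  | one => simpa [meixnerPoly, meixnerOmega] using hX 0
  | more n h0 h1 =>
    have h2 := hX (n + 1)
    rw [Nat.add_sub_cancel] at h2
    rw [meixnerPoly]
    simp only [map_sub, map_mul, aeval_X, aeval_C, LinearMap.sub_apply, Module.End.mul_apply,
      Module.algebraMap_end_apply, h0, h1, h2]
    module

end Ladder

section Abstract

open Polynomial

variable {V : Type*} [NormedAddCommGroup V] [InnerProductSpace ℝ V]
  {Am N Ap : (ℝ × ℝ) →ₗ[ℝ] Module.End ℝ V} {Ω : V}

/-- In the eigenbasis `e`, the operators `Am + N + Ap` in the two directions act on the vacuum like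
independent centered variables with Meixner recurrences: the mixed products of their orthogonal
polynomials have mean zero. -/
theorem LadderSystem.exists_meixner (hL : LadderSystem Am N Ap Ω) :
    ∃ (e : Fin 2 → ℝ × ℝ) (α β : Fin 2 → ℝ), LinearIndependent ℝ e ∧ (∀ i, α i = 0 → β i = 0) ∧
      ∀ m n : ℕ, m ≠ 0 ∨ n ≠ 0 →
        inner ℝ (aeval (Am (e 0) + N (e 0) + Ap (e 0)) (meixnerPoly (α 0) (β 0) m)
          (aeval (Am (e 1) + N (e 1) + Ap (e 1)) (meixnerPoly (α 1) (β 1) n) Ω)) Ω = 0 := by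
  obtain ⟨e, α, G, horth, hNA, hMA, hαG⟩ := hL.exists_splitting
  have horth' : ∀ i j, Am (e i) (Ap (e j) Ω) = (if i = j then (1 : ℝ) else 0) • Ω := by
    intro i j
    obtain ⟨c, q, hq⟩ := hL.exists_am_ap (e i) (e j)
    have h1 := LinearMap.congr_fun hq Ω
    simp [hL.am_vac, hL.n_vac] at h1
    have h2 : inner ℝ (Ap (e i) Ω) (Ap (e j) Ω) = c := by
      rw [hL.inner_ap, h1, real_inner_smul_right, hL.inner_vac, mul_one]
    rw [h1, ← horth, h2]
  have hMvac : ∀ i j, (Am (e i) * Ap (e j) - Ap (e j) * Am (e i)) Ω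
      = (if i = j then (1 : ℝ) else 0) • Ω := fun i j => by
    rw [← horth', LinearMap.sub_apply, Module.End.mul_apply, Module.End.mul_apply, hL.am_vac,
      map_zero, sub_zero]
  have hX : ∀ i j, i ≠ j → ∀ m n : ℕ,
      (Am (e i) + N (e i) + Ap (e i)) ((Ap (e i) ^ m) ((Ap (e j) ^ n) Ω))
        = (Ap (e i) ^ (m + 1)) ((Ap (e j) ^ n) Ω)
          + (α i * m) • (Ap (e i) ^ m) ((Ap (e j) ^ n) Ω)
          + meixnerOmega (G i / 2) m • (Ap (e i) ^ (m - 1)) ((Ap (e j) ^ n) Ω) := by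
    intro i j hij m n
    -- eigenvalues of the diagonal operators on the vectors created from the vacuum
    have hN1 : N (e i) ((Ap (e j) ^ n) Ω) = (0 : ℝ) • (Ap (e j) ^ n) Ω := by
      have h1 := hNA i j
      rw [if_neg hij] at h1
      have := eigen_pow_of_commutator (l := 0) h1 (u := Ω) (by simp [hL.n_vac]) n
      rwa [zero_mul, add_zero] at this
    have hN2 : N (e i) ((Ap (e i) ^ m) ((Ap (e j) ^ n) Ω))
        = (α i * m) • (Ap (e i) ^ m) ((Ap (e j) ^ n) Ω) := by
      have h1 := hNA i i
      rw [if_pos rfl] at h1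
      have := eigen_pow_of_commutator h1 hN1 m
      rwa [zero_add] at this
    have hcross : ∀ k : ℕ, (Am (e i) * Ap (e j) - Ap (e j) * Am (e i)) ((Ap (e j) ^ k) Ω) = 0 := by
      intro k
      have h1 := hMA i j j
      rw [if_neg (fun hc => hij hc.1)] at h1
      have h2 := hMvac i j
      rw [if_neg hij] at h2
      simpa using eigen_pow_of_commutator h1 h2 k
    -- the annihilation operator in direction `i` passes through the other direction
    have hAm0 : ∀ k : ℕ, Am (e i) ((Ap (e j) ^ k) Ω) = 0 := by
      intro k
      induction k with
      | zero => simp [hL.am_vac]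
      | succ k ih =>
        have h1 := hcross k
        rw [LinearMap.sub_apply, Module.End.mul_apply, Module.End.mul_apply, ih, map_zero,
          sub_zero] at h1
        rw [pow_succ', Module.End.mul_apply, h1]
    have hself1 : (Am (e i) * Ap (e i) - Ap (e i) * Am (e i)) ((Ap (e j) ^ n) Ω)
        = (1 : ℝ) • (Ap (e j) ^ n) Ω := by
      have h1 := hMA i i j
      rw [if_neg (fun hc => hij hc.2)] at h1
      have h2 := hMvac i i
      rw [if_pos rfl] at h2
      simpa using eigen_pow_of_commutator h1 h2 n
    have hself2 : ∀ k : ℕ, (Am (e i) * Ap (e i) - Ap (e i) * Am (e i))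
        ((Ap (e i) ^ k) ((Ap (e j) ^ n) Ω))
        = (1 + G i * k) • (Ap (e i) ^ k) ((Ap (e j) ^ n) Ω) := by
      intro k
      have h1 := hMA i i i
      rw [if_pos ⟨rfl, rfl⟩] at h1
      exact eigen_pow_of_commutator h1 hself1 k
    have hAm : ∀ k : ℕ, Am (e i) ((Ap (e i) ^ k) ((Ap (e j) ^ n) Ω))
        = meixnerOmega (G i / 2) k • (Ap (e i) ^ (k - 1)) ((Ap (e j) ^ n) Ω) := by
      intro k
      induction k with
      | zero => simp [hAm0, meixnerOmega]
      | succ k ih =>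
        have h1 := hself2 k
        rw [LinearMap.sub_apply, Module.End.mul_apply, Module.End.mul_apply, ih, map_smul,
          sub_eq_iff_eq_add] at h1
        rw [pow_succ', Module.End.mul_apply, h1, Nat.add_sub_cancel]
        cases k with
        | zero => simp [meixnerOmega]
        | succ k =>
          rw [Nat.add_sub_cancel, ← Module.End.mul_apply (Ap (e i)) (Ap (e i) ^ k), ← pow_succ',
            ← add_smul]
          congr 1
          simp only [meixnerOmega]
          push_cast
          ring
    rw [LinearMap.add_apply, LinearMap.add_apply, hN2, hAm, pow_succ', Module.End.mul_apply]
    abel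
  refine ⟨e, α, fun i => G i / 2, ?_, fun i hi => by simp [hαG i hi], ?_⟩
  · have hli : LinearIndependent ℝ (fun i => Ap.flip Ω (e i)) := by
      refine Orthonormal.linearIndependent (orthonormal_iff_ite.2 horth)
    exact LinearIndependent.of_comp (Ap.flip Ω) hli
  · intro m n hmn
    have h1 : aeval (Am (e 1) + N (e 1) + Ap (e 1)) (meixnerPoly (α 1) (G 1 / 2) n) Ω
        = (Ap (e 1) ^ n) Ω :=
      aeval_meixnerPoly (fun k => by simpa using hX 1 0 (by decide) k 0) n
    have h0 : aeval (Am (e 0) + N (e 0) + Ap (e 0)) (meixnerPoly (α 0) (G 0 / 2) m)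
        ((Ap (e 1) ^ n) Ω) = (Ap (e 0) ^ m) ((Ap (e 1) ^ n) Ω) :=
      aeval_meixnerPoly (fun k => hX 0 1 (by decide) k n) m
    rw [h1, h0]
    rcases Nat.eq_zero_or_pos m with rfl | hm
    · obtain ⟨k, rfl⟩ := Nat.exists_eq_succ_of_ne_zero (hmn.resolve_left (by simp))
      rw [pow_zero, Nat.succ_eq_add_one, pow_succ', Module.End.one_apply, Module.End.mul_apply,
        hL.inner_ap, hL.am_vac, inner_zero_right]
    · obtain ⟨k, rfl⟩ := Nat.exists_eq_succ_of_ne_zero hm.ne'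
      rw [Nat.succ_eq_add_one, pow_succ', Module.End.mul_apply, hL.inner_ap, hL.am_vac,
        inner_zero_right]

end Abstract

/-! ### The ladder system of a measure of class `M_L` -/

section Concrete

open Polynomial

variable {μ : Measure (ℝ × ℝ)} (h : HasFiniteMoments μ)

theorem inner_centered (v : ℝ × ℝ) (u w : polySpace h) :
    inner ℝ (centered h v u) w = inner ℝ u (centered h v w) := by
  have := inner_ladder h 0 v u w
  rw [neg_zero] at this
  simp only [centered_apply, LinearMap.sub_apply, LinearMap.smul_apply, Module.End.one_apply,
    inner_sub_left, inner_sub_right, real_inner_smul_left, real_inner_smul_right, this]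

theorem commutator_sub_smul_one {V : Type*} [AddCommGroup V] [Module ℝ V] (A B : Module.End ℝ V)
    (c : ℝ) : (A - c • 1) * B - B * (A - c • 1) = A * B - B * A := by
  rw [sub_mul, mul_sub, smul_one_mul, mul_smul_one, sub_sub_sub_cancel_right]

theorem centered_commutator (v : ℝ × ℝ) (B : Module.End ℝ (polySpace h)) :
    centered h v * B - B * centered h v = ladder h 0 v * B - B * ladder h 0 v :=
  commutator_sub_smul_one _ _ _

theorem centered_commutator_centered (v w : ℝ × ℝ) :
    centered h v * centered h w - centered h w * centered h v
      = ladder h 0 v * ladder h 0 w - ladder h 0 w * ladder h 0 v := by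
  rw [centered_commutator, ← neg_sub, centered_commutator, neg_sub]

theorem exists_commutator_zero_one
    (hlie : ∀ A ∈ apcSpan h, ∀ B ∈ apcSpan h, A * B - B * A ∈ apcSpan h) (v w : ℝ × ℝ) :
    ∃ r, ladder h 0 v * ladder h 1 w - ladder h 1 w * ladder h 0 v = ladder h 1 r := by
  have h1 := hlie _ (ladder_mem_apcSpan h (Or.inr (Or.inl rfl)) v) _
    (ladder_mem_apcSpan h (Or.inr (Or.inr rfl)) w)
  have h2 := (isHomog_ladder h 0 v).commutator (isHomog_ladder h 1 w)
  rw [zero_add] at h2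
  exact (exists_of_mem_apcSpan_of_isHomog h h1).1 h2

theorem exists_commutator_neg_one_one
    (hlie : ∀ A ∈ apcSpan h, ∀ B ∈ apcSpan h, A * B - B * A ∈ apcSpan h) (v w : ℝ × ℝ) :
    ∃ (c : ℝ) (q : ℝ × ℝ), ladder h (-1) v * ladder h 1 w - ladder h 1 w * ladder h (-1) v
      = c • 1 + centered h q := by
  have h1 := hlie _ (ladder_mem_apcSpan h (Or.inl rfl) v) _
    (ladder_mem_apcSpan h (Or.inr (Or.inr rfl)) w)
  have h2 := (isHomog_ladder h (-1) v).commutator (isHomog_ladder h 1 w)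
  rw [neg_add_cancel] at h2
  obtain ⟨c, q, hq⟩ := (exists_of_mem_apcSpan_of_isHomog h h1).2 h2
  refine ⟨c + formMean h q, q, ?_⟩
  rw [hq, centered_apply]
  module

theorem centered_vac [IsProbabilityMeasure μ] (v : ℝ × ℝ) : centered h v (vac h) = 0 := by
  rw [centered_apply, LinearMap.sub_apply, ladder_zero_vac, LinearMap.smul_apply,
    Module.End.one_apply, sub_self]

theorem centered_ladder_comm (v w : ℝ × ℝ) :
    centered h v * ladder h 1 w - ladder h 1 w * centered h v
      = centered h w * ladder h 1 v - ladder h 1 v * centered h w := by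
  rw [centered_commutator, centered_commutator, ladder_zero_one_comm]

theorem centered_degree_zero (v w : ℝ × ℝ) :
    (ladder h (-1) v * ladder h 1 w - ladder h 1 w * ladder h (-1) v)
      + (centered h v * centered h w - centered h w * centered h v)
      + (ladder h 1 v * ladder h (-1) w - ladder h (-1) w * ladder h 1 v) = 0 := by
  rw [centered_commutator_centered, ladder_degree_zero]

theorem ladderSystem_of_lie [IsProbabilityMeasure μ]
    (hlie : ∀ A ∈ apcSpan h, ∀ B ∈ apcSpan h, A * B - B * A ∈ apcSpan h)
    (hline : ∀ l : Set (ℝ × ℝ), IsLine l → ¬ IsSupportedOn μ l) :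
    LadderSystem (ladder h (-1)) (centered h) (ladder h 1) (vac h) where
  am_vac := ladder_neg_one_vac h
  n_vac := centered_vac h
  inner_vac := inner_vac_vac h
  inner_ap := inner_ladder h 1
  inner_n := inner_centered h
  ap_comm := ladder_one_comm h
  n_ap_comm := centered_ladder_comm h
  degree_zero := centered_degree_zero h
  exists_n_ap v w := by
    obtain ⟨r, hr⟩ := exists_commutator_zero_one h hlie v w
    exact ⟨r, (centered_commutator h v (ladder h 1 w)).trans hr⟩
  exists_am_ap := exists_commutator_neg_one_one h hlie
  injective v := eq_zero_of_ladder_one_vac h hline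

theorem ladder_add_centered (v : ℝ × ℝ) :
    ladder h (-1) v + centered h v + ladder h 1 v = formMul h v - formMean h v • 1 := by
  rw [formMul_eq, centered_apply]
  abel

theorem aeval_formMul_ae (v : ℝ × ℝ) (c : ℝ) (p : ℝ[X]) (u : polySpace h) :
    (aeval (formMul h v - c • 1) p u : Lp ℝ 2 μ) =ᵐ[μ]
      fun z => p.eval (v.1 * z.1 + v.2 * z.2 - c) * (u : Lp ℝ 2 μ) z := by
  have hT : ∀ u : polySpace h, ((formMul h v - c • 1 : Module.End ℝ (polySpace h)) u : Lp ℝ 2 μ)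
      =ᵐ[μ] fun z => (v.1 * z.1 + v.2 * z.2 - c) * (u : Lp ℝ 2 μ) z := by
    intro u
    rw [LinearMap.sub_apply, LinearMap.smul_apply, Module.End.one_apply, Submodule.coe_sub,
      Submodule.coe_smul]
    filter_upwards [formMul_ae h v u, Lp.coeFn_sub (formMul h v u : Lp ℝ 2 μ) (c • (u : Lp ℝ 2 μ)),
      Lp.coeFn_smul c (u : Lp ℝ 2 μ)] with z h1 h2 h3
    rw [h2, Pi.sub_apply, h1, h3, Pi.smul_apply, smul_eq_mul]
    ring
  induction p using Polynomial.induction_on' with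
  | add p q hp hq =>
    rw [map_add, LinearMap.add_apply, Submodule.coe_add]
    filter_upwards [hp, hq, Lp.coeFn_add (aeval (formMul h v - c • 1) p u : Lp ℝ 2 μ)
      (aeval (formMul h v - c • 1) q u : Lp ℝ 2 μ)] with z h1 h2 h3
    rw [h3, Pi.add_apply, h1, h2, eval_add]
    ring
  | monomial n a =>
    have hn : (((formMul h v - c • 1) ^ n : Module.End ℝ (polySpace h)) u : Lp ℝ 2 μ) =ᵐ[μ]
        fun z => (v.1 * z.1 + v.2 * z.2 - c) ^ n * (u : Lp ℝ 2 μ) z := by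
      induction n with
      | zero => simp
      | succ n ih =>
        rw [pow_succ', Module.End.mul_apply]
        filter_upwards [hT (((formMul h v - c • 1) ^ n) u), ih] with z h1 h2
        rw [h1, h2]
        ring
    have h1 : aeval (formMul h v - c • 1) (monomial n a) u
        = a • (((formMul h v - c • 1) ^ n : Module.End ℝ (polySpace h)) u) := by
      rw [aeval_monomial, Module.End.mul_apply, Module.algebraMap_end_apply]
    rw [h1, Submodule.coe_smul]
    filter_upwards [hn, Lp.coeFn_smul a
      (((formMul h v - c • 1) ^ n : Module.End ℝ (polySpace h)) u : Lp ℝ 2 μ)] with z h2 h3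
    rw [h3, Pi.smul_apply, h2, eval_monomial, smul_eq_mul]
    ring

/-- The affine function `z ↦ v.1 * z.1 + v.2 * z.2 - c` on the plane. -/
def affineForm (v : ℝ × ℝ) (c : ℝ) (z : ℝ × ℝ) : ℝ := v.1 * z.1 + v.2 * z.2 - c

theorem continuous_affineForm (v : ℝ × ℝ) (c : ℝ) : Continuous (affineForm v c) := by
  unfold affineForm
  fun_prop

/-- A Meixner measure of class `M_L` on the plane has affine coordinates whose Meixner polynomials
have vanishing mixed means. -/
theorem exists_affine_meixner [IsProbabilityMeasure μ]
    (hlie : ∀ A ∈ apcSpan h, ∀ B ∈ apcSpan h, A * B - B * A ∈ apcSpan h)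
    (hline : ∀ l : Set (ℝ × ℝ), IsLine l → ¬ IsSupportedOn μ l) :
    ∃ (e : Fin 2 → ℝ × ℝ) (c α β : Fin 2 → ℝ), LinearIndependent ℝ e ∧
      (∀ i, α i = 0 → β i = 0) ∧
      ∀ m n : ℕ, m ≠ 0 ∨ n ≠ 0 →
        ∫ z, (meixnerPoly (α 0) (β 0) m).eval (affineForm (e 0) (c 0) z) *
          (meixnerPoly (α 1) (β 1) n).eval (affineForm (e 1) (c 1) z) ∂μ = 0 := by
  obtain ⟨e, α, β, hli, hαβ, hint⟩ := (ladderSystem_of_lie h hlie hline).exists_meixner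
  refine ⟨e, fun i => formMean h (e i), α, β, hli, hαβ, fun m n hmn => ?_⟩
  have h1 := hint m n hmn
  rw [inner_vac, ladder_add_centered, ladder_add_centered] at h1
  rw [← h1]
  refine integral_congr_ae ?_
  filter_upwards [aeval_formMul_ae h (e 0) (formMean h (e 0)) (meixnerPoly (α 0) (β 0) m)
    (aeval (formMul h (e 1) - formMean h (e 1) • 1) (meixnerPoly (α 1) (β 1) n) (vac h)),
    aeval_formMul_ae h (e 1) (formMean h (e 1)) (meixnerPoly (α 1) (β 1) n) (vac h),
    vac_ae h] with z h2 h3 h4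
  rw [h2, h3, h4, mul_one]
  rfl

end Concrete

/-! ### Measures on the line with Meixner recurrences -/

section OneDim

open Polynomial

variable {ν : Measure ℝ}

theorem HasFiniteMoments.integrable_eval [IsProbabilityMeasure ν] (hν : HasFiniteMoments ν)
    (q : ℝ[X]) : Integrable (fun x => q.eval x) ν := by
  induction q using Polynomial.induction_on' with
  | add p q hp hq =>
    simp only [eval_add]
    exact hp.add hq
  | monomial n a =>
    simp only [eval_monomial]
    refine Integrable.const_mul ?_ a
    refine (hν n).mono' (by fun_prop) (Filter.Eventually.of_forall fun x => ?_)
    rw [norm_pow]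

/-- The mean of a polynomial, as a linear functional. -/
noncomputable def polyIntegral [IsProbabilityMeasure ν] (hν : HasFiniteMoments ν) :
    ℝ[X] →ₗ[ℝ] ℝ where
  toFun q := ∫ x, q.eval x ∂ν
  map_add' p q := by
    simp only [eval_add]
    exact integral_add (hν.integrable_eval p) (hν.integrable_eval q)
  map_smul' c p := by
    simp only [eval_smul, smul_eq_mul, RingHom.id_apply]
    exact integral_const_mul _ _

theorem monic_meixnerPoly (α β : ℝ) (n : ℕ) :
    (meixnerPoly α β n).Monic ∧ (meixnerPoly α β n).natDegree = n := by
  induction n using Nat.twoStepInduction with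
  | zero => simp [meixnerPoly]
  | one => simp [meixnerPoly, monic_X]
  | more n h0 h1 =>
    have hm : ((X - C (α * (n + 1 : ℕ))) * meixnerPoly α β (n + 1)).Monic :=
      (monic_X_sub_C _).mul h1.1
    have hd : ((X - C (α * (n + 1 : ℕ))) * meixnerPoly α β (n + 1)).natDegree = n + 2 := by
      rw [(monic_X_sub_C _).natDegree_mul h1.1, natDegree_X_sub_C, h1.2]
      ring
    have hlt : (C (meixnerOmega β (n + 1)) * meixnerPoly α β n).degree
        < ((X - C (α * (n + 1 : ℕ))) * meixnerPoly α β (n + 1)).degree := by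
      rw [degree_eq_natDegree hm.ne_zero, hd]
      rw [← smul_eq_C_mul]
      refine (degree_smul_le _ _).trans_lt ?_
      rw [degree_eq_natDegree h0.1.ne_zero, h0.2]
      exact_mod_cast (by omega : n < n + 2)
    refine ⟨hm.sub_of_left hlt, ?_⟩
    rw [meixnerPoly, natDegree_eq_of_degree_eq (degree_sub_eq_left_of_degree_lt hlt), hd]

/-- The squared norm `ω_1 ⋯ ω_n` of the orthogonal polynomial of degree `n`. -/
noncomputable def meixnerNormSq (β : ℝ) (n : ℕ) : ℝ := ∏ k ∈ Finset.range n, meixnerOmega β (k + 1)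

theorem meixnerNormSq_succ (β : ℝ) (n : ℕ) :
    meixnerNormSq β (n + 1) = meixnerNormSq β n * meixnerOmega β (n + 1) :=
  Finset.prod_range_succ _ _

theorem meixnerOmega_zero (β : ℝ) : meixnerOmega β 0 = 0 := by simp [meixnerOmega]

variable [IsProbabilityMeasure ν] (hν : HasFiniteMoments ν) {α β : ℝ}

theorem polyIntegral_X_pow_succ_mul (j n : ℕ) :
    polyIntegral hν (X ^ (j + 1) * meixnerPoly α β n)
      = polyIntegral hν (X ^ j * meixnerPoly α β (n + 1))
        + (α * n) * polyIntegral hν (X ^ j * meixnerPoly α β n)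
        + meixnerOmega β n * polyIntegral hν (X ^ j * meixnerPoly α β (n - 1)) := by
  rw [pow_succ, mul_assoc, X_mul_meixnerPoly, ← smul_eq_C_mul, ← smul_eq_C_mul, mul_add, mul_add,
    mul_smul_comm, mul_smul_comm, map_add, map_add, map_smul, map_smul, smul_eq_mul, smul_eq_mul]

variable (hp : ∀ n, n ≠ 0 → ∫ x, (meixnerPoly α β n).eval x ∂ν = 0)

include hν hp

/-- Favard's argument: the three-term recurrence and vanishing means already give
orthogonality. -/
theorem polyIntegral_X_pow_mul (j n : ℕ) :
    (j < n → polyIntegral hν (X ^ j * meixnerPoly α β n) = 0) ∧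
    (j = n → polyIntegral hν (X ^ j * meixnerPoly α β n) = meixnerNormSq β n) := by
  induction j generalizing n with
  | zero =>
    refine ⟨fun hn => ?_, fun hn => ?_⟩
    · rw [pow_zero, one_mul]
      exact hp n hn.ne'
    · subst hn
      simp [polyIntegral, meixnerPoly, meixnerNormSq]
  | succ j ih =>
    rw [polyIntegral_X_pow_succ_mul hν]
    refine ⟨fun hn => ?_, fun hn => ?_⟩
    · rw [(ih (n + 1)).1 (by omega), (ih n).1 (by omega), (ih (n - 1)).1 (by omega)]
      ring
    · subst hn
      rw [(ih (j + 1 + 1)).1 (by omega), (ih (j + 1)).1 (by omega), Nat.add_sub_cancel,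
        (ih j).2 rfl, meixnerNormSq_succ]
      ring

theorem polyIntegral_mul {q : ℝ[X]} {n : ℕ} (hq : q.natDegree ≤ n) :
    polyIntegral hν (q * meixnerPoly α β n) = q.coeff n * meixnerNormSq β n := by
  rw [q.as_sum_range_C_mul_X_pow' (Nat.lt_succ_of_le hq), Finset.sum_mul, map_sum,
    ← q.as_sum_range_C_mul_X_pow' (Nat.lt_succ_of_le hq), Finset.sum_eq_single n]
  · rw [mul_assoc, ← smul_eq_C_mul, map_smul, (polyIntegral_X_pow_mul hν hp n n).2 rfl, smul_eq_mul]
  · intro i hi hin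
    rw [mul_assoc, ← smul_eq_C_mul, map_smul, (polyIntegral_X_pow_mul hν hp i n).1, smul_zero]
    have := Finset.mem_range.1 hi
    omega
  · simp

theorem polyNormSq_meixnerPoly (n : ℕ) : polyNormSq ν (meixnerPoly α β n) = meixnerNormSq β n := by
  have h1 := polyIntegral_mul hν hp (monic_meixnerPoly α β n).2.le
  have h2 : (meixnerPoly α β n).coeff n = 1 := by
    have := (monic_meixnerPoly α β n).1.coeff_natDegree
    rwa [(monic_meixnerPoly α β n).2] at this
  rw [h2, one_mul] at h1
  rw [← h1, polyNormSq]
  simp [polyIntegral, sq]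

theorem polyMean_meixnerPoly {n : ℕ} (hn : meixnerNormSq β n ≠ 0) :
    polyMean ν (meixnerPoly α β n) = α * n := by
  rw [polyMean, polyNormSq_meixnerPoly hν hp, div_eq_iff hn]
  have h1 : ∫ x, x * (meixnerPoly α β n).eval x ^ 2 ∂ν
      = polyIntegral hν ((X * meixnerPoly α β n) * meixnerPoly α β n) := by
    simp [polyIntegral, sq, mul_assoc]
  have h2 : polyIntegral hν (meixnerPoly α β (n + 1) * meixnerPoly α β n) = 0 := by
    rw [mul_comm, polyIntegral_mul hν hp ((monic_meixnerPoly α β n).2.le.trans n.le_succ),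
      coeff_eq_zero_of_natDegree_lt (by rw [(monic_meixnerPoly α β n).2]; omega), zero_mul]
  have h3 : meixnerOmega β n * polyIntegral hν (meixnerPoly α β (n - 1) * meixnerPoly α β n)
      = 0 := by
    cases n with
    | zero => rw [meixnerOmega_zero, zero_mul]
    | succ n =>
      rw [Nat.add_sub_cancel,
        polyIntegral_mul hν hp ((monic_meixnerPoly α β n).2.le.trans n.le_succ),
        coeff_eq_zero_of_natDegree_lt (by rw [(monic_meixnerPoly α β n).2]; omega), zero_mul,
        mul_zero]
  have h4 : polyIntegral hν (meixnerPoly α β n * meixnerPoly α β n) = meixnerNormSq β n := by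
    rw [← polyNormSq_meixnerPoly hν hp, polyNormSq]
    simp [polyIntegral, sq]
  rw [h1, X_mul_meixnerPoly, add_mul, add_mul, map_add, map_add, h2, mul_assoc, mul_assoc,
    ← smul_eq_C_mul, ← smul_eq_C_mul, map_smul, map_smul, smul_eq_mul, smul_eq_mul, h3, h4]
  ring

/-- As long as no squared norm vanishes, no quotient in the recurrence of `orthoPoly` is a junk
value. -/
theorem orthoPoly_eq_meixnerPoly {k : ℕ} (hk : ∀ m < k, meixnerNormSq β m ≠ 0) :
    ∀ n ≤ k, orthoPoly ν n = meixnerPoly α β n := by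
  intro n
  induction n using Nat.twoStepInduction with
  | zero => intro _; rw [orthoPoly, meixnerPoly]
  | one =>
    intro _
    have h1 := polyMean_meixnerPoly hν hp (n := 0) (by simp [meixnerNormSq])
    rw [meixnerPoly] at h1
    rw [orthoPoly, meixnerPoly, h1]
    simp
  | more n h0 h1 =>
    intro hn
    rw [orthoPoly, h0 (by omega), h1 (by omega), polyMean_meixnerPoly hν hp (hk (n + 1) (by omega)),
      polyNormSq_meixnerPoly hν hp, polyNormSq_meixnerPoly hν hp, meixnerNormSq_succ,
      mul_div_cancel_left₀ _ (hk n (by omega)), meixnerPoly]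

theorem jacobiAlpha_eq {k : ℕ} (hk : ∀ m < k, meixnerNormSq β m ≠ 0) {n : ℕ} (hn : n < k) :
    jacobiAlpha ν n = α * n := by
  rw [jacobiAlpha, orthoPoly_eq_meixnerPoly hν hp hk n hn.le, polyMean_meixnerPoly hν hp (hk n hn)]

theorem jacobiOmega_eq {k : ℕ} (hk : ∀ m < k, meixnerNormSq β m ≠ 0) {n : ℕ} (hn1 : 1 ≤ n)
    (hn : n < k) : jacobiOmega ν n = meixnerOmega β n := by
  obtain ⟨m, rfl⟩ := Nat.exists_eq_add_of_le' hn1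
  rw [jacobiOmega, orthoPoly_eq_meixnerPoly hν hp hk _ hn.le, Nat.add_sub_cancel,
    orthoPoly_eq_meixnerPoly hν hp hk m (by omega), polyNormSq_meixnerPoly hν hp,
    polyNormSq_meixnerPoly hν hp, meixnerNormSq_succ, mul_div_cancel_left₀ _ (hk m (by omega))]

/-- A support of exactly `m` points forces the orthogonal polynomial of degree `m` to be null:
it is orthogonal to itself, because the monic polynomial with these roots is. -/
theorem meixnerNormSq_ncard_support (hfin : ν.support.Finite) :
    meixnerNormSq β ν.support.ncard = 0 := by
  classical
  set s := hfin.toFinset with hs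
  set q : ℝ[X] := ∏ a ∈ s, (X - C a) with hq
  have hcard : ν.support.ncard = s.card := Set.ncard_eq_toFinset_card _ hfin
  have hmonic : q.Monic := monic_prod_X_sub_C _ _
  have hdeg : q.natDegree = ν.support.ncard := by
    rw [hcard, hq, natDegree_finsetProd_X_sub_C_eq_card]
  have h1 := polyIntegral_mul hν hp hdeg.le
  have h2 : q.coeff ν.support.ncard = 1 := by rw [← hdeg]; exact hmonic.coeff_natDegree
  rw [h2, one_mul] at h1
  rw [← h1]
  refine integral_eq_zero_of_ae ?_
  filter_upwards [Measure.support_mem_ae (μ := ν)] with x hx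
  have : q.eval x = 0 := by
    rw [hq, eval_prod]
    exact Finset.prod_eq_zero (hfin.mem_toFinset.2 hx) (by simp)
  simp [this]

theorem meixnerNormSq_nonneg (n : ℕ) : 0 ≤ meixnerNormSq β n := by
  rw [← polyNormSq_meixnerPoly hν hp]
  exact integral_nonneg fun x => sq_nonneg _

theorem support_encard_le {n : ℕ} (hn : meixnerNormSq β n = 0) : ν.support.encard ≤ n := by
  have h1 : ∫ x, (meixnerPoly α β n).eval x ^ 2 ∂ν = 0 := by
    rw [← hn, ← polyNormSq_meixnerPoly hν hp, polyNormSq]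
  have hint : Integrable (fun x => (meixnerPoly α β n).eval x ^ 2) ν := by
    refine (hν.integrable_eval (meixnerPoly α β n ^ 2)).congr (Filter.Eventually.of_forall ?_)
    exact fun x => eval_pow 2
  have h2 := (integral_eq_zero_iff_of_nonneg (fun x => sq_nonneg _) hint).1 h1
  have hne := (monic_meixnerPoly α β n).1.ne_zero
  have h3 : ν.support ⊆ ((meixnerPoly α β n).roots.toFinset : Set ℝ) := by
    refine Measure.support_subset_of_isClosed (Finset.finite_toSet _).isClosed ?_
    filter_upwards [h2] with x hx
    simpa [hne] using hx
  refine (Set.encard_le_encard h3).trans ?_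
  rw [Set.encard_coe_eq_coe_finsetCard]
  have h4 := (Multiset.toFinset_card_le _).trans ((meixnerPoly α β n).card_roots')
  rw [(monic_meixnerPoly α β n).2] at h4
  exact_mod_cast h4

/-- A probability measure whose Meixner polynomials of positive degree have mean zero is of class
`M_L`: the support is infinite if all `ω_n` are positive, and otherwise the first nonpositive `ω_k`
vanishes, so that the measure is binomial on `k` points. -/
theorem isMeixnerLie_of_integral_meixnerPoly (hαβ : α = 0 → β = 0) : IsMeixnerLie ν := by
  refine ⟨inferInstance, hν, ?_⟩
  have hω1 : meixnerOmega β 1 = 1 := by simp [meixnerOmega]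
  by_cases hpos : ∀ n, 1 ≤ n → 0 < meixnerOmega β n
  · have hP : ∀ n, 0 < meixnerNormSq β n := fun n =>
      Finset.prod_pos fun k _ => hpos (k + 1) (by omega)
    have hβ : 0 ≤ β := by
      by_contra hneg
      rw [not_le] at hneg
      obtain ⟨n, hn⟩ := exists_nat_gt (1 / -β)
      rw [div_lt_iff₀ (by linarith)] at hn
      have h1 := hpos (n + 1) (by omega)
      rw [meixnerOmega] at h1
      have h2 := pos_of_mul_pos_right h1 (by positivity)
      push_cast at h2
      linarith
    refine Or.inl ⟨fun hfin => (hP _).ne' (meixnerNormSq_ncard_support hν hp hfin), α, β, 1, hβ,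
      one_pos, ?_, fun n => ?_, fun n hn => ?_⟩
    · by_cases hα : α = 0
      · exact Or.inr ⟨hα, hαβ hα⟩
      · exact Or.inl hα
    · rw [jacobiAlpha_eq hν hp (k := n + 1) (fun m _ => (hP m).ne') (by omega),
        jacobiAlpha_eq hν hp (k := n + 1) (fun m _ => (hP m).ne') (by omega)]
      simp
    · rw [jacobiOmega_eq hν hp (k := n + 1) (fun m _ => (hP m).ne') hn (by omega), meixnerOmega]
      ring
  · -- the first nonpositive `ω_k` has to vanish, since squared norms are nonnegative
    push Not at hpos
    classical
    have hk := Nat.find_spec hpos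
    set k := Nat.find hpos
    have hmin : ∀ m, 1 ≤ m → m < k → 0 < meixnerOmega β m := fun m hm hmk => by
      have := Nat.find_min hpos hmk
      push Not at this
      exact this hm
    have hP : ∀ m < k, 0 < meixnerNormSq β m := fun m hm =>
      Finset.prod_pos fun j hj => hmin (j + 1) (by omega) (by have := Finset.mem_range.1 hj; omega)
    obtain ⟨l, hl⟩ := Nat.exists_eq_add_of_le' hk.1
    have hsucc := meixnerNormSq_succ β l
    rw [← hl] at hsucc
    have hPk := meixnerNormSq_nonneg hν hp k
    have hPl := hP l (by omega)
    have hωk : meixnerOmega β k = 0 := by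
      refine le_antisymm hk.2 ?_
      rw [hsucc] at hPk
      exact nonneg_of_mul_nonneg_right hPk hPl
    have hPk0 : meixnerNormSq β k = 0 := by rw [hsucc, hωk, mul_zero]
    have hle := support_encard_le hν hp hPk0
    have hfin : ν.support.Finite := Set.finite_of_encard_le_coe hle
    have hge : k ≤ ν.support.ncard := by
      by_contra hlt
      exact (hP _ (not_le.1 hlt)).ne' (meixnerNormSq_ncard_support hν hp hfin)
    have hcard : ν.support.encard = k := by
      refine le_antisymm hle ?_
      rw [← hfin.cast_ncard_eq]
      exact_mod_cast hge
    have hβk : 1 + β * ((k : ℝ) - 1) = 0 := by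
      rw [meixnerOmega] at hωk
      refine (mul_eq_zero.1 hωk).resolve_left ?_
      exact_mod_cast (by omega : k ≠ 0)
    refine Or.inr ⟨k, hk.1, hcard, α, β, 1, ?_, fun _ => one_pos, by linarith, fun n hn => ?_,
      fun n hn hnk => ?_⟩
    · intro hα
      rw [hαβ hα] at hβk
      simp at hβk
    · rw [jacobiAlpha_eq hν hp (fun m hm => (hP m hm).ne') hn,
        jacobiAlpha_eq hν hp (fun m hm => (hP m hm).ne') (by omega : 0 < k)]
      simp
    · rw [jacobiOmega_eq hν hp (fun m hm => (hP m hm).ne') hn hnk, meixnerOmega]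
      ring

/-- The moments grow at most like those of an exponential distribution. -/
theorem exists_moment_bound : ∃ D : ℝ, 0 < D ∧ ∀ n : ℕ, |∫ x, x ^ n ∂ν| ≤ D ^ n * n.factorial := by
  obtain ⟨A, hA⟩ : ∃ A : ℝ, A = 1 + |α| + |β| := ⟨_, rfl⟩
  have hα0 := abs_nonneg α
  have hβ0 := abs_nonneg β
  have hA0 : 0 < A := by linarith
  have key : ∀ n k : ℕ, |polyIntegral hν (X ^ n * meixnerPoly α β k)|
      ≤ (2 * (1 + 2 * A)) ^ n * n.factorial * k.factorial := by
    intro n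
    induction n with
    | zero =>
      intro k
      rcases Nat.eq_zero_or_pos k with rfl | hk
      · rw [(polyIntegral_X_pow_mul hν hp 0 0).2 rfl]
        simp [meixnerNormSq]
      · rw [(polyIntegral_X_pow_mul hν hp 0 k).1 hk, abs_zero]
        positivity
    | succ n ih =>
      intro k
      rcases lt_or_ge (n + 1) k with hk | hk
      · rw [(polyIntegral_X_pow_mul hν hp (n + 1) k).1 hk, abs_zero]
        positivity
      · rw [polyIntegral_X_pow_succ_mul hν]
        -- three terms of the recurrence, each at most linear in `n` times the bound for `n`
        set B : ℝ := (2 * (1 + 2 * A)) ^ n * n.factorial with hB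
        have hB0 : 0 ≤ B := by positivity
        have t1 : |polyIntegral hν (X ^ n * meixnerPoly α β (k + 1))|
            ≤ B * k.factorial * (k + 1) := by
          refine (ih (k + 1)).trans_eq ?_
          rw [Nat.factorial_succ]
          push_cast
          ring
        have t2 : |α * k * polyIntegral hν (X ^ n * meixnerPoly α β k)|
            ≤ B * k.factorial * (A * k) := by
          rw [abs_mul, abs_mul, Nat.abs_cast]
          have h1 : |α| * k ≤ A * k := by gcongr; linarith
          calc _ ≤ (A * k) * (B * k.factorial) := by
                exact mul_le_mul h1 (ih k) (abs_nonneg _) (by positivity)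
            _ = _ := by ring
        have t3 : |meixnerOmega β k * polyIntegral hν (X ^ n * meixnerPoly α β (k - 1))|
            ≤ B * k.factorial * (A * k) := by
          rcases Nat.eq_zero_or_pos k with rfl | hk0
          · simp [meixnerOmega_zero]
          · obtain ⟨m, rfl⟩ := Nat.exists_eq_add_of_le' hk0
            rw [Nat.add_sub_cancel, abs_mul]
            have h1 : |meixnerOmega β (m + 1)| ≤ A * (m + 1) * (m + 1) := by
              rw [meixnerOmega]
              push_cast
              rw [add_sub_cancel_right, abs_mul, abs_of_nonneg (by positivity : (0 : ℝ) ≤ m + 1),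
                mul_comm]
              gcongr
              refine (abs_add_le _ _).trans ?_
              rw [abs_one, abs_mul, Nat.abs_cast, hA]
              nlinarith [mul_nonneg hα0 (Nat.cast_nonneg (α := ℝ) m), Nat.cast_nonneg (α := ℝ) m]
            calc _ ≤ (A * (m + 1) * (m + 1)) * (B * m.factorial) := by
                  exact mul_le_mul h1 (ih m) (abs_nonneg _) (by positivity)
              _ = _ := by
                  rw [Nat.factorial_succ]
                  push_cast
                  ring
        have hkn : (k : ℝ) ≤ n + 1 := by exact_mod_cast hk
        calc _ ≤ B * k.factorial * (k + 1) + B * k.factorial * (A * k)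
              + B * k.factorial * (A * k) :=
              (abs_add_three _ _ _).trans (add_le_add (add_le_add t1 t2) t3)
          _ = B * k.factorial * (k + 1 + 2 * A * k) := by ring
          _ ≤ B * k.factorial * (2 * (1 + 2 * A) * (n + 1)) := by
              gcongr
              nlinarith [mul_nonneg hA0.le (sub_nonneg.2 hkn), Nat.cast_nonneg (α := ℝ) n]
          _ = _ := by
              rw [hB, Nat.factorial_succ, pow_succ]
              push_cast
              ring
  refine ⟨2 * (1 + 2 * A), by positivity, fun n => ?_⟩
  have h1 := key n 0
  have h2 : polyIntegral hν (X ^ n * meixnerPoly α β 0) = ∫ x, x ^ n ∂ν := by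
    simp [polyIntegral, meixnerPoly]
  rw [h2] at h1
  simpa using h1

end OneDim

/-! ### Determinacy of moments -/

section Determinacy

open ProbabilityTheory Polynomial

/-- The polynomials `meixnerPoly α β n` span, by the three-term recurrence. -/
theorem meixnerPoly_linearMap_ext (α β : ℝ) {φ ψ : ℝ[X] →ₗ[ℝ] ℝ}
    (hφψ : ∀ n, φ (meixnerPoly α β n) = ψ (meixnerPoly α β n)) : φ = ψ := by
  have key : ∀ j n : ℕ, φ (X ^ j * meixnerPoly α β n) = ψ (X ^ j * meixnerPoly α β n) := by
    intro j
    induction j with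
    | zero => intro n; rw [pow_zero, one_mul, hφψ]
    | succ j ih =>
      intro n
      rw [pow_succ, mul_assoc, X_mul_meixnerPoly, ← smul_eq_C_mul, ← smul_eq_C_mul, mul_add,
        mul_add, mul_smul_comm, mul_smul_comm]
      simp only [map_add, map_smul, ih]
  ext j
  simpa [meixnerPoly, ← X_pow_eq_monomial] using key j 0

variable {Ω Ω' : Type*} {mΩ : MeasurableSpace Ω} {mΩ' : MeasurableSpace Ω'}
  {P : Measure Ω} {Q : Measure Ω'} {X : Ω → ℝ} {Y : Ω' → ℝ}

theorem zero_mem_interior_integrableExpSet_iff :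
    0 ∈ interior (integrableExpSet X P)
      ↔ ∃ δ > 0, ∀ r : ℝ, |r| < δ → Integrable (fun ω => Real.exp (r * X ω)) P := by
  rw [mem_interior_iff_mem_nhds, Metric.mem_nhds_iff]
  refine exists_congr fun δ => and_congr_right fun _ => ?_
  refine forall_congr' fun r => ?_
  rw [mem_ball_zero_iff, Real.norm_eq_abs]
  rfl

/-- Moments of at most exponential type give exponential integrability: expand `cosh (r X)`. -/
theorem zero_mem_interior_integrableExpSet_of_moments (hX : Measurable X)
    (hint : ∀ n : ℕ, Integrable (fun ω => X ω ^ n) P) {D : ℝ} (hD : 0 < D)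
    (hm : ∀ n : ℕ, |∫ ω, X ω ^ n ∂P| ≤ D ^ n * n.factorial) :
    0 ∈ interior (integrableExpSet X P) := by
  refine zero_mem_interior_integrableExpSet_iff.2 ⟨1 / D, by positivity, fun r hr => ?_⟩
  have hrD : |r| * D < 1 := by rwa [lt_div_iff₀ hD] at hr
  have hnn : ∀ (x : ℝ) (n : ℕ), 0 ≤ x ^ (2 * n) / (2 * n).factorial := fun x n => by
    rw [pow_mul]; positivity
  have hterm : ∀ n : ℕ, ∫⁻ ω, ENNReal.ofReal ((r * X ω) ^ (2 * n) / (2 * n).factorial) ∂P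
      ≤ ENNReal.ofReal (((|r| * D) ^ 2) ^ n) := by
    intro n
    have h1 : Integrable (fun ω => (r * X ω) ^ (2 * n) / (2 * n).factorial) P := by
      simp only [mul_pow]
      exact ((hint (2 * n)).const_mul _).div_const _
    rw [← ofReal_integral_eq_lintegral_ofReal h1 (Filter.Eventually.of_forall fun ω => hnn _ n)]
    refine ENNReal.ofReal_le_ofReal ?_
    simp only [mul_pow, integral_div, integral_const_mul]
    rw [div_le_iff₀ (by positivity)]
    have h2 := (le_abs_self _).trans (hm (2 * n))
    have h3 : r ^ (2 * n) = (|r| ^ 2) ^ n := by rw [sq_abs, pow_mul]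
    rw [h3]
    calc (|r| ^ 2) ^ n * ∫ ω, X ω ^ (2 * n) ∂P
        ≤ (|r| ^ 2) ^ n * (D ^ (2 * n) * (2 * n).factorial) := by gcongr
      _ = (|r| ^ 2) ^ n * (D ^ 2) ^ n * (2 * n).factorial := by rw [pow_mul]; ring
  have hcosh : ∫⁻ ω, ENNReal.ofReal (Real.cosh (r * X ω)) ∂P < ⊤ := by
    have h1 : ∀ ω, ENNReal.ofReal (Real.cosh (r * X ω))
        = ∑' n : ℕ, ENNReal.ofReal ((r * X ω) ^ (2 * n) / (2 * n).factorial) := fun ω => by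
      rw [← ENNReal.ofReal_tsum_of_nonneg (hnn _) (Real.hasSum_cosh _).summable,
        (Real.hasSum_cosh _).tsum_eq]
    simp only [h1]
    rw [lintegral_tsum fun n => by fun_prop]
    refine (ENNReal.tsum_le_tsum hterm).trans_lt ?_
    have hlt : (|r| * D) ^ 2 < 1 := by
      have : 0 ≤ |r| * D := by positivity
      nlinarith
    rw [← ENNReal.ofReal_tsum_of_nonneg (fun n => by positivity)
      (summable_geometric_of_lt_one (by positivity) hlt)]
    exact ENNReal.ofReal_lt_top
  have hcint : Integrable (fun ω => Real.cosh (r * X ω)) P := by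
    refine ⟨by fun_prop, ?_⟩
    rw [hasFiniteIntegral_iff_ofReal
      (Filter.Eventually.of_forall fun ω => (Real.cosh_pos _).le)]
    exact hcosh
  refine (hcint.const_mul 2).mono' (by fun_prop) (Filter.Eventually.of_forall fun ω => ?_)
  rw [Real.norm_eq_abs, Real.abs_exp, Real.cosh_eq]
  have := Real.exp_pos (-(r * X ω))
  linarith

/-- Exponentially integrable variables with equal moments have the same characteristic function:
it extends analytically to a strip, and the moments are its derivatives at `0`. -/
theorem complexMGF_I_eq_of_moments (hX : 0 ∈ interior (integrableExpSet X P))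
    (hY : 0 ∈ interior (integrableExpSet Y Q))
    (hm : ∀ n : ℕ, ∫ ω, X ω ^ n ∂P = ∫ ω, Y ω ^ n ∂Q) :
    complexMGF X P Complex.I = complexMGF Y Q Complex.I := by
  set s : Set ℝ := interior (integrableExpSet X P) ∩ interior (integrableExpSet Y Q)
  have hconv : Convex ℝ s :=
    convex_integrableExpSet.interior.inter convex_integrableExpSet.interior
  have hpre : IsPreconnected {z : ℂ | z.re ∈ s} :=
    (hconv.linear_preimage Complex.reLm).isPreconnected
  have hXa : AnalyticOnNhd ℂ (complexMGF X P) {z | z.re ∈ s} :=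
    analyticOnNhd_complexMGF.mono fun z hz => hz.1
  have hYa : AnalyticOnNhd ℂ (complexMGF Y Q) {z | z.re ∈ s} :=
    analyticOnNhd_complexMGF.mono fun z hz => hz.2
  have h0 : (0 : ℂ) ∈ {z : ℂ | z.re ∈ s} := ⟨by simpa using hX, by simpa using hY⟩
  have hI : Complex.I ∈ {z : ℂ | z.re ∈ s} := ⟨by simpa using hX, by simpa using hY⟩
  have hder : ∀ n, iteratedDeriv n (complexMGF X P) 0 = iteratedDeriv n (complexMGF Y Q) 0 := by
    intro n
    rw [iteratedDeriv_complexMGF h0.1, iteratedDeriv_complexMGF h0.2]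
    simp only [zero_mul, Complex.exp_zero, mul_one, ← Complex.ofReal_pow]
    rw [integral_complex_ofReal, integral_complex_ofReal, hm]
  have hloc : complexMGF X P =ᶠ[nhds 0] complexMGF Y Q := by
    have h1 := (hXa 0 h0).hasFPowerSeriesAt
    have h2 := (hYa 0 h0).hasFPowerSeriesAt
    simp only [hder] at h1
    filter_upwards [h1.eventually_hasSum, h2.eventually_hasSum] with z hz1 hz2
    rw [zero_add] at hz1 hz2
    exact hz1.unique hz2
  exact hXa.eqOn_of_preconnected_of_eventuallyEq hYa hpre h0 hloc hI

end Determinacy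

section Independence

open ProbabilityTheory

variable {Ω : Type*} {mΩ : MeasurableSpace Ω} {P : Measure Ω} [IsProbabilityMeasure P]
  {X Y : Ω → ℝ}

/-- Exponentially integrable variables whose mixed moments factor are independent. -/
theorem map_prod_eq_of_moments (hXm : Measurable X) (hYm : Measurable Y)
    (hX : 0 ∈ interior (integrableExpSet X P)) (hY : 0 ∈ interior (integrableExpSet Y P))
    (hint : ∀ a b : ℕ, Integrable (fun ω => X ω ^ a * Y ω ^ b) P)
    (hmom : ∀ a b : ℕ, ∫ ω, X ω ^ a * Y ω ^ b ∂P = (∫ ω, X ω ^ a ∂P) * ∫ ω, Y ω ^ b ∂P) :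
    P.map (fun ω => (X ω, Y ω)) = (P.map X).prod (P.map Y) := by
  have : IsProbabilityMeasure (P.map X) := Measure.isProbabilityMeasure_map hXm.aemeasurable
  have : IsProbabilityMeasure (P.map Y) := Measure.isProbabilityMeasure_map hYm.aemeasurable
  have : IsProbabilityMeasure (P.map fun ω => (X ω, Y ω)) :=
    Measure.isProbabilityMeasure_map (hXm.prodMk hYm).aemeasurable
  have hXY : Measurable fun ω => (X ω, Y ω) := hXm.prodMk hYm
  obtain ⟨δ₁, hδ₁, h₁⟩ := zero_mem_interior_integrableExpSet_iff.1 hX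
  obtain ⟨δ₂, hδ₂, h₂⟩ := zero_mem_interior_integrableExpSet_iff.1 hY
  refine Measure.ext_of_charFunDual (funext fun L => ?_)
  obtain ⟨s, hs⟩ : ∃ s, s = L (1, 0) := ⟨_, rfl⟩
  obtain ⟨t, ht⟩ : ∃ t, t = L (0, 1) := ⟨_, rfl⟩
  have hL : ∀ v : ℝ × ℝ, L v = s * v.1 + t * v.2 := fun v => by
    have : v = v.1 • (1, 0) + v.2 • (0, 1) := by ext <;> simp
    conv_lhs => rw [this]
    rw [map_add, map_smul, map_smul, hs, ht, smul_eq_mul, smul_eq_mul, mul_comm, mul_comm v.2]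
  set Z : ℝ × ℝ → ℝ := fun v => s * v.1 + t * v.2 with hZ
  have hZc : Continuous Z := by fun_prop
  have hchar : ∀ R : Measure (ℝ × ℝ), charFunDual R L = complexMGF Z R Complex.I := fun R => by
    rw [charFunDual_apply, complexMGF]
    refine integral_congr_ae (Filter.Eventually.of_forall fun v => ?_)
    simp only [hL, hZ, mul_comm]
  obtain ⟨M, hM⟩ : ∃ M, M = 2 * (|s| + |t| + 1) := ⟨_, rfl⟩
  have hM0 : 0 < M := by rw [hM]; positivity
  have hsM : 2 * |s| ≤ M := by rw [hM]; linarith [abs_nonneg t]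
  have htM : 2 * |t| ≤ M := by rw [hM]; linarith [abs_nonneg s]
  -- both `2 r s` and `2 r t` are exponents at which the exponential moments are finite
  have hsmall : ∀ r : ℝ, |r| < min δ₁ δ₂ / M → |2 * (r * s)| < δ₁ ∧ |2 * (r * t)| < δ₂ := by
    intro r hr
    rw [lt_div_iff₀ hM0] at hr
    have hs1 : |2 * (r * s)| = |r| * (2 * |s|) := by
      rw [abs_mul, abs_mul, abs_two]; ring
    have ht1 : |2 * (r * t)| = |r| * (2 * |t|) := by
      rw [abs_mul, abs_mul, abs_two]; ring
    rw [hs1, ht1]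
    exact ⟨((mul_le_mul_of_nonneg_left hsM (abs_nonneg r)).trans_lt hr).trans_le (min_le_left _ _),
      ((mul_le_mul_of_nonneg_left htM (abs_nonneg r)).trans_lt hr).trans_le (min_le_right _ _)⟩
  rw [hchar, hchar]
  refine complexMGF_I_eq_of_moments ?_ ?_ fun n => ?_
  · refine zero_mem_interior_integrableExpSet_iff.2
      ⟨min δ₁ δ₂ / M, div_pos (lt_min hδ₁ hδ₂) hM0, fun r hr => ?_⟩
    rw [integrable_map_measure (by fun_prop) hXY.aemeasurable]
    refine ((h₁ _ (hsmall r hr).1).add (h₂ _ (hsmall r hr).2)).mono'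
      (by fun_prop) (Filter.Eventually.of_forall fun ω => ?_)
    simp only [Function.comp_apply, hZ, Real.norm_eq_abs, Real.abs_exp, Pi.add_apply]
    have e1 : Real.exp (r * (s * X ω + t * Y ω))
        = Real.exp (r * s * X ω) * Real.exp (r * t * Y ω) := by
      rw [← Real.exp_add]; ring_nf
    have e2 : Real.exp (2 * (r * s) * X ω) = Real.exp (r * s * X ω) ^ 2 := by
      rw [← Real.exp_nat_mul]; push_cast; ring_nf
    have e3 : Real.exp (2 * (r * t) * Y ω) = Real.exp (r * t * Y ω) ^ 2 := by
      rw [← Real.exp_nat_mul]; push_cast; ring_nf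
    rw [e1, e2, e3]
    nlinarith [sq_nonneg (Real.exp (r * s * X ω) - Real.exp (r * t * Y ω)),
      sq_nonneg (Real.exp (r * s * X ω)), sq_nonneg (Real.exp (r * t * Y ω))]
  · refine zero_mem_interior_integrableExpSet_iff.2
      ⟨min δ₁ δ₂ / M, div_pos (lt_min hδ₁ hδ₂) hM0, fun r hr => ?_⟩
    have hhalf : |r * s| < δ₁ ∧ |r * t| < δ₂ := by
      have h := hsmall r hr
      rw [abs_mul 2, abs_mul 2, abs_two] at h
      exact ⟨by linarith [h.1, abs_nonneg (r * s)], by linarith [h.2, abs_nonneg (r * t)]⟩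
    have i1 : Integrable (fun x => Real.exp (r * s * x)) (P.map X) :=
      (integrable_map_measure (by fun_prop) hXm.aemeasurable).2 (h₁ _ hhalf.1)
    have i2 : Integrable (fun x => Real.exp (r * t * x)) (P.map Y) :=
      (integrable_map_measure (by fun_prop) hYm.aemeasurable).2 (h₂ _ hhalf.2)
    refine (i1.mul_prod i2).congr (Filter.Eventually.of_forall fun v => ?_)
    simp only [hZ]
    rw [← Real.exp_add]
    ring_nf
  · have hintX : ∀ a : ℕ, Integrable (fun x => x ^ a) (P.map X) := fun a => by
      refine (integrable_map_measure (by fun_prop) hXm.aemeasurable).2 ?_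
      simpa [Function.comp_def] using hint a 0
    have hintY : ∀ a : ℕ, Integrable (fun x => x ^ a) (P.map Y) := fun a => by
      refine (integrable_map_measure (by fun_prop) hYm.aemeasurable).2 ?_
      simpa [Function.comp_def] using hint 0 a
    have hterm : ∀ (v : ℝ × ℝ), Z v ^ n = ∑ m ∈ Finset.range (n + 1),
        (s ^ m * t ^ (n - m) * n.choose m) * (v.1 ^ m * v.2 ^ (n - m)) := fun v => by
      simp only [hZ, add_pow, mul_pow]
      exact Finset.sum_congr rfl fun m _ => by ring
    simp only [hterm]
    rw [integral_finsetSum, integral_finsetSum]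
    · refine Finset.sum_congr rfl fun m _ => ?_
      rw [integral_const_mul, integral_const_mul, integral_map hXY.aemeasurable (by fun_prop),
        integral_prod_mul (fun x : ℝ => x ^ m) (fun y : ℝ => y ^ (n - m)), hmom,
        integral_map hXm.aemeasurable (by fun_prop), integral_map hYm.aemeasurable (by fun_prop)]
    · exact fun m _ => ((hintX m).mul_prod (hintY (n - m))).const_mul _
    · intro m _
      have : Integrable (fun v : ℝ × ℝ => v.1 ^ m * v.2 ^ (n - m))
          (P.map fun ω => (X ω, Y ω)) :=
        (integrable_map_measure (by fun_prop) hXY.aemeasurable).2 (hint m (n - m))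
      exact this.const_mul _

end Independence

/-! ### Factorization of the measure -/

section Affine

open ProbabilityTheory Polynomial

variable {μ : Measure (ℝ × ℝ)}

theorem HasFiniteMoments.integrable_affineForm_pow [IsProbabilityMeasure μ]
    (h : HasFiniteMoments μ) (v w : ℝ × ℝ) (c d : ℝ) (a b : ℕ) :
    Integrable (fun z => affineForm v c z ^ a * affineForm w d z ^ b) μ := by
  have hbound : ∀ v c, ∃ M, 0 ≤ M ∧ ∀ z : ℝ × ℝ, |affineForm v c z| ≤ M * (1 + ‖z‖) := by
    intro v c
    refine ⟨|v.1| + |v.2| + |c|, by positivity, fun z => ?_⟩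
    have h1 : |z.1| ≤ ‖z‖ := norm_fst_le z
    have h2 : |z.2| ≤ ‖z‖ := norm_snd_le z
    have h3 : |affineForm v c z| ≤ |v.1| * |z.1| + |v.2| * |z.2| + |c| := by
      rw [affineForm, ← abs_mul, ← abs_mul]
      exact (abs_sub _ _).trans (add_le_add_left (abs_add_le _ _) _)
    nlinarith [mul_le_mul_of_nonneg_left h1 (abs_nonneg v.1),
      mul_le_mul_of_nonneg_left h2 (abs_nonneg v.2), abs_nonneg v.1, abs_nonneg v.2, abs_nonneg c,
      norm_nonneg z, mul_nonneg (abs_nonneg c) (norm_nonneg z)]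
  obtain ⟨M, hM, h1⟩ := hbound v c
  obtain ⟨K, hK, h2⟩ := hbound w d
  have hc1 := continuous_affineForm v c
  have hc2 := continuous_affineForm w d
  have hdom : Integrable (fun z => M ^ a * K ^ b * (2 ^ (a + b - 1) * (1 + ‖z‖ ^ (a + b)))) μ :=
    (((integrable_const 1).add (h (a + b))).const_mul _).const_mul _
  refine hdom.mono' (by fun_prop) (Filter.Eventually.of_forall fun z => ?_)
  have h4 := add_pow_le zero_le_one (norm_nonneg z) (a + b)
  rw [one_pow] at h4
  rw [Real.norm_eq_abs, abs_mul, abs_pow, abs_pow]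
  calc |affineForm v c z| ^ a * |affineForm w d z| ^ b
      ≤ (M * (1 + ‖z‖)) ^ a * (K * (1 + ‖z‖)) ^ b := by
        gcongr
        · exact h1 z
        · exact h2 z
    _ = M ^ a * K ^ b * (1 + ‖z‖) ^ (a + b) := by rw [mul_pow, mul_pow, pow_add]; ring
    _ ≤ _ := by gcongr

end Affine

section MixedMean

open Polynomial

variable {Ω : Type*} {mΩ : MeasurableSpace Ω} {P : Measure Ω} {X Y : Ω → ℝ}

theorem integrable_eval_mul_eval (hint : ∀ a b : ℕ, Integrable (fun ω => X ω ^ a * Y ω ^ b) P)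
    (p q : ℝ[X]) : Integrable (fun ω => p.eval (X ω) * q.eval (Y ω)) P := by
  induction p using Polynomial.induction_on' with
  | add p p' hp hp' =>
    simp only [eval_add, add_mul]
    exact hp.add hp'
  | monomial a r =>
    induction q using Polynomial.induction_on' with
    | add q q' hq hq' =>
      simp only [eval_add, mul_add]
      exact hq.add hq'
    | monomial b s =>
      simp only [eval_monomial]
      refine ((hint a b).const_mul (r * s)).congr (Filter.Eventually.of_forall fun ω => ?_)
      ring

/-- The bilinear functional `p, q ↦ ∫ p(X) q(Y)` on polynomials. -/
noncomputable def mixedMean (hint : ∀ a b : ℕ, Integrable (fun ω => X ω ^ a * Y ω ^ b) P) :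
    ℝ[X] →ₗ[ℝ] ℝ[X] →ₗ[ℝ] ℝ :=
  LinearMap.mk₂ ℝ (fun p q => ∫ ω, p.eval (X ω) * q.eval (Y ω) ∂P)
    (fun p p' q => by
      simp only [eval_add, add_mul]
      exact integral_add (integrable_eval_mul_eval hint p q) (integrable_eval_mul_eval hint p' q))
    (fun c p q => by simp only [eval_smul, smul_eq_mul, mul_assoc, integral_const_mul])
    (fun p q q' => by
      simp only [eval_add, mul_add]
      exact integral_add (integrable_eval_mul_eval hint p q) (integrable_eval_mul_eval hint p q'))
    (fun c p q => by
      simp only [eval_smul, smul_eq_mul, mul_left_comm _ c, integral_const_mul])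

theorem mixedMean_apply (hint : ∀ a b : ℕ, Integrable (fun ω => X ω ^ a * Y ω ^ b) P)
    (p q : ℝ[X]) : mixedMean hint p q = ∫ ω, p.eval (X ω) * q.eval (Y ω) ∂P := rfl

/-- Vanishing mixed means of the Meixner polynomials make all mixed moments factor. -/
theorem integral_pow_mul_pow [IsProbabilityMeasure P]
    (hint : ∀ a b : ℕ, Integrable (fun ω => X ω ^ a * Y ω ^ b) P) {α β α' β' : ℝ}
    (hmix : ∀ m n : ℕ, m ≠ 0 ∨ n ≠ 0 →
      ∫ ω, (meixnerPoly α β m).eval (X ω) * (meixnerPoly α' β' n).eval (Y ω) ∂P = 0) (a b : ℕ) :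
    ∫ ω, X ω ^ a * Y ω ^ b ∂P = (∫ ω, X ω ^ a ∂P) * ∫ ω, Y ω ^ b ∂P := by
  have h0 : ∀ m, m ≠ 0 → mixedMean hint (meixnerPoly α β m) = 0 := fun m hm =>
    meixnerPoly_linearMap_ext α' β' fun n => hmix m n (Or.inl hm)
  have h11 : mixedMean hint 1 1 = 1 := by simp [mixedMean_apply]
  have key : ∀ q, (mixedMean hint).flip q
      = mixedMean hint 1 q • (mixedMean hint).flip 1 := fun q => by
    refine meixnerPoly_linearMap_ext α β fun m => ?_
    simp only [LinearMap.flip_apply, LinearMap.smul_apply, smul_eq_mul]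
    rcases Nat.eq_zero_or_pos m with rfl | hm
    · rw [meixnerPoly, h11, mul_one]
    · rw [h0 m hm.ne', LinearMap.zero_apply, LinearMap.zero_apply, mul_zero]
  have h1 := LinearMap.congr_fun (key (Polynomial.X ^ b)) (Polynomial.X ^ a)
  simpa [mixedMean_apply, mul_comm] using h1

end MixedMean

section Main

open ProbabilityTheory Polynomial

variable {μ : Measure (ℝ × ℝ)}

/-- The invertible linear map of the plane with rows `e 0` and `e 1`. -/
noncomputable def rowEquiv {e : Fin 2 → ℝ × ℝ} (he : LinearIndependent ℝ e) :
    (ℝ × ℝ) ≃ₗ[ℝ] (ℝ × ℝ) :=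
  LinearEquiv.ofInjectiveEndo
    { toFun := fun z => ((e 0).1 * z.1 + (e 0).2 * z.2, (e 1).1 * z.1 + (e 1).2 * z.2)
      map_add' := fun z w => by ext <;> simp <;> ring
      map_smul' := fun r z => by ext <;> simp <;> ring }
    (by
      have hpair : LinearIndependent ℝ ![e 0, e 1] := by
        convert he using 1
        ext i <;> fin_cases i <;> rfl
      rw [LinearIndependent.pair_iff] at hpair
      have hdet : (e 0).1 * (e 1).2 - (e 0).2 * (e 1).1 ≠ 0 := by
        intro hd
        have h1 := hpair (e 1).2 (-(e 0).2) (Prod.ext (by simp; linarith) (by simp; ring))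
        have h2 := hpair (-(e 1).1) (e 0).1 (Prod.ext (by simp; ring) (by simp; linarith))
        exact one_ne_zero (hpair 1 0
          (Prod.ext (by simpa using h2.2) (by simpa using h1.2))).1
      rw [injective_iff_map_eq_zero]
      intro z hz
      have h1 := congrArg Prod.fst hz
      have h2 := congrArg Prod.snd hz
      simp only [LinearMap.coe_mk, AddHom.coe_mk, Prod.fst_zero, Prod.snd_zero] at h1 h2
      refine Prod.ext ?_ ?_
      · refine (mul_eq_zero.1 ?_).resolve_left hdet
        linear_combination (e 1).2 * h1 - (e 0).2 * h2
      · refine (mul_eq_zero.1 ?_).resolve_left hdet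
        linear_combination (e 0).1 * h2 - (e 1).1 * h1)

theorem rowEquiv_apply {e : Fin 2 → ℝ × ℝ} (he : LinearIndependent ℝ e) (z : ℝ × ℝ) :
    rowEquiv he z = ((e 0).1 * z.1 + (e 0).2 * z.2, (e 1).1 * z.1 + (e 1).2 * z.2) := rfl

theorem isMeixnerLie_map_affineForm [IsProbabilityMeasure μ] (h : HasFiniteMoments μ)
    {v : ℝ × ℝ} {c α β : ℝ} (hαβ : α = 0 → β = 0)
    (hp : ∀ n, n ≠ 0 → ∫ z, (meixnerPoly α β n).eval (affineForm v c z) ∂μ = 0) :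
    IsMeixnerLie (μ.map (affineForm v c)) ∧
      0 ∈ interior (integrableExpSet (affineForm v c) μ) := by
  have hm := (continuous_affineForm v c).measurable
  have : IsProbabilityMeasure (μ.map (affineForm v c)) :=
    Measure.isProbabilityMeasure_map hm.aemeasurable
  have hpow : ∀ n : ℕ, Integrable (fun z => affineForm v c z ^ n) μ := fun n => by
    simpa using h.integrable_affineForm_pow v v c c n 0
  have hν : HasFiniteMoments (μ.map (affineForm v c)) := fun n => by
    rw [integrable_map_measure (by fun_prop) hm.aemeasurable]
    simpa [Function.comp_def] using (hpow n).norm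
  have hp' : ∀ n, n ≠ 0 → ∫ x, (meixnerPoly α β n).eval x ∂μ.map (affineForm v c) = 0 := by
    intro n hn
    rw [integral_map hm.aemeasurable (meixnerPoly α β n).continuous.aestronglyMeasurable]
    exact hp n hn
  refine ⟨isMeixnerLie_of_integral_meixnerPoly hν hp' hαβ, ?_⟩
  obtain ⟨D, hD, hb⟩ := exists_moment_bound hν hp'
  refine zero_mem_interior_integrableExpSet_of_moments hm hpow hD fun n => ?_
  have := hb n
  rwa [integral_map hm.aemeasurable (by fun_prop)] at this

/-- If the law of a nondegenerate affine form has finite support, the measure is carried by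
finitely many lines, the level sets of the form. -/
theorem exists_lines_of_finite_support [IsProbabilityMeasure μ] {v : ℝ × ℝ} (hv : v ≠ 0) {c : ℝ}
    (hfin : (μ.map (affineForm v c)).support.Finite) :
    ∃ 𝓛 : Set (Set (ℝ × ℝ)), 𝓛.Finite ∧ (∀ l ∈ 𝓛, IsLine l) ∧ IsSupportedOn μ (⋃₀ 𝓛) := by
  refine ⟨(fun x => {z : ℝ × ℝ | v.1 * z.1 + v.2 * z.2 = x + c}) ''
    (μ.map (affineForm v c)).support, hfin.image _, ?_, ?_⟩
  · rintro _ ⟨x, -, rfl⟩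
    refine ⟨v.1, v.2, x + c, ?_, rfl⟩
    by_contra hle
    exact hv (Prod.ext (by simp; nlinarith [sq_nonneg v.1, sq_nonneg v.2])
      (by simp; nlinarith [sq_nonneg v.1, sq_nonneg v.2]))
  · have h1 : ∀ᵐ z ∂μ, affineForm v c z ∈ (μ.map (affineForm v c)).support :=
      ae_of_ae_map (continuous_affineForm v c).aemeasurable Measure.support_mem_ae
    rw [ae_iff] at h1
    refine measure_mono_null ?_ h1
    intro z hz hmem
    exact hz ⟨_, ⟨_, hmem, rfl⟩, by simp [affineForm]⟩

theorem mainTheorem2 (μ : Measure (ℝ × ℝ)) (hμ : IsMeixnerLiePlane μ)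
    (hline : ∀ l : Set (ℝ × ℝ), IsLine l → ¬ IsSupportedOn μ l) :
    (∃ (S : (ℝ × ℝ) ≃ₗ[ℝ] (ℝ × ℝ)) (c : ℝ × ℝ) (μ₁ μ₂ : Measure ℝ),
      IsMeixnerLie μ₁ ∧ IsMeixnerLie μ₂ ∧
      ∀ B : Set (ℝ × ℝ), MeasurableSet B →
        μ ((fun z => S z + c) '' B) = (μ₁.prod μ₂) B) ∧
    ((∀ 𝓛 : Set (Set (ℝ × ℝ)), 𝓛.Finite → (∀ l ∈ 𝓛, IsLine l) →
        ¬ IsSupportedOn μ (⋃₀ 𝓛)) →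
      ∃ (S : (ℝ × ℝ) ≃ₗ[ℝ] (ℝ × ℝ)) (c : ℝ × ℝ) (μ₁ μ₂ : Measure ℝ),
        IsMeixnerLie μ₁ ∧ IsMeixnerLie μ₂ ∧
        μ₁.support.Infinite ∧ μ₂.support.Infinite ∧
        ∀ B : Set (ℝ × ℝ), MeasurableSet B →
          μ ((fun z => S z + c) '' B) = (μ₁.prod μ₂) B) := by
  obtain ⟨hprob, h, hlie⟩ := hμ
  obtain ⟨e, c, α, β, hli, hαβ, hmix⟩ := exists_affine_meixner h hlie hline
  obtain ⟨hM0, hE0⟩ := isMeixnerLie_map_affineForm h (v := e 0) (c := c 0) (hαβ 0)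
    fun n hn => by simpa [meixnerPoly] using hmix n 0 (Or.inl hn)
  obtain ⟨hM1, hE1⟩ := isMeixnerLie_map_affineForm h (v := e 1) (c := c 1) (hαβ 1)
    fun n hn => by simpa [meixnerPoly] using hmix 0 n (Or.inr hn)
  have hint := h.integrable_affineForm_pow (e 0) (e 1) (c 0) (c 1)
  have hm0 := (continuous_affineForm (e 0) (c 0)).measurable
  have hm1 := (continuous_affineForm (e 1) (c 1)).measurable
  have hprod := map_prod_eq_of_moments hm0 hm1 hE0 hE1 hint (integral_pow_mul_pow hint hmix)
  have himage : ∀ B : Set (ℝ × ℝ), MeasurableSet B →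
      μ ((fun z => (rowEquiv hli).symm z + (rowEquiv hli).symm (c 0, c 1)) '' B)
        = ((μ.map (affineForm (e 0) (c 0))).prod (μ.map (affineForm (e 1) (c 1)))) B := by
    intro B hB
    rw [← hprod, Measure.map_apply (hm0.prodMk hm1) hB]
    congr 1
    have hT : ∀ z, (affineForm (e 0) (c 0) z, affineForm (e 1) (c 1) z)
        = rowEquiv hli z - (c 0, c 1) := fun z => by
      rw [rowEquiv_apply]; rfl
    ext z
    simp only [Set.mem_image, Set.mem_preimage, hT]
    constructor
    · rintro ⟨w, hw, rfl⟩
      simpa using hw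
    · intro hz
      exact ⟨_, hz, by simp⟩
  refine ⟨⟨_, _, _, _, hM0, hM1, himage⟩, fun hlines => ⟨_, _, _, _, hM0, hM1, ?_, ?_, himage⟩⟩
  · intro hfin
    obtain ⟨𝓛, h1, h2, h3⟩ := exists_lines_of_finite_support (hli.ne_zero 0) hfin
    exact hlines 𝓛 h1 h2 h3
  · intro hfin
    obtain ⟨𝓛, h1, h2, h3⟩ := exists_lines_of_finite_support (hli.ne_zero 1) hfin
    exact hlines 𝓛 h1 h2 h3

end Main
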